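/- \textbf{Setting.} Let $\overline{\mathbb R}=\mathbb R\cup\{+\infty\}$ and $\operatorname{dom}\psi=\{\psi<+\infty\}$. For $\psi:\mathbb R^N\to\overline{\mathbb R}$ and a point $\bar x$ at which $\psi$ is finite, the Fréchet subdifferential is $\hat\partial\psi(\bar x)=\{v:\liminf_{x\to\bar x,\,x\ne\bar x}\frac{\psi(x)-\psi(\bar x)-\langle v,x-\bar x\rangle}{\|x-\bar x\|}\ge 0\}$, and the limiting subdifferential $\partial\psi(\bar x)$ is the set of limits $v=\lim v^k$ with $v^k\in\hat\partial\psi(x^k)$, $x^k\to\bar x$, $\psi(x^k)\to\psi(\bar x)$; both are empty where $\psi=+\infty$. Let $\operatorname{dom}\partial\psi=\{\partial\psi\neq\emptyset\}$, $\psi^*(z)=\sup_x\{\langle x,z\rangle-\psi(x)\}$, and let $\iota_{\mathcal S}$ be the indicator function of $\mathcal S$ ($0$ on $\mathcal S$, $+\infty$ elsewhere). $\psi$ has the \emph{KL property} at $\hat x\in\operatorname{dom}\partial\psi$ if there are $a\in(0,\infty]$, a neighbourhood $U$ of $\hat x$ and a continuous concave $\phi:[0,a)\to[0,\infty)$ with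 $\phi(0)=0$, continuously differentiable with $\phi'>0$ on $(0,a)$, such that $\phi'(\psi(x)-\psi(\hat x))\operatorname{dist}(0,\partial\psi(x))\ge1$ for all $x\in U$ with $\psi(\hat x)<\psi(x)<\psi(\hat x)+a$ (with $\operatorname{dist}(0,\emptyset)=+\infty$). $\psi$ is \emph{calm} at $\bar x\in\operatorname{dom}\psi$ if there are $\varrho,\varepsilon>0$ with $|\psi(\bar x)-\psi(x)|\le\varrho\|\bar x-x\|$ for all $x\in B(\bar x,\varepsilon)$ (in particular $\psi$ is finite on this ball). Consider $\min_{x\in\mathcal S}\frac{g(x)+h(x)}{f(Kx)}$, where $K:\mathbb R^n\to\mathbb R^p$ is linear. \textbf{Assumption 1.} $\mathcal S\subseteq\mathbb R^n$ is nonempty, convex and compact; $g:\mathbb R^n\to\overline{\mathbb R}$ is proper, convex and lower semicontinuous; $h:\mathbb R^n\to\mathbb R$ is differentiable on an open set containing $\mathcal S$, with gradient Lipschitz continuous there with constant $L_{\nabla h}\ge 0$; $f:\mathbb R^p\to\overline{\mathbb R}$ is proper, convex and lower semicontinuous with $K(\mathcal S)\subseteq\operatorname{int}(\operatorname{dom}f)$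 and $f(Kx)>0$ for all $x\in\mathcal S$; $\mathcal S\cap\operatorname{dom}g\ne\emptyset$ and $\inf_{x\in\mathcal S}\{g(x)+h(x)\}\ge0$. \textbf{Assumption 2.} $\operatorname{ri}(\mathcal S)\cap\operatorname{ri}(\operatorname{dom}g)\neq\emptyset$, or $\mathcal S$ is polyhedral and $\mathcal S\cap\operatorname{ri}(\operatorname{dom}g)\ne\emptyset$. \textbf{Algorithm (FPSA).} Let $0<\sigma<2$ and $\delta>0$ with $\delta L_{\nabla h}<1$. Put $$\varphi(x,u)=g(x)+h(x)+\iota_{\mathcal S}(x)+\tfrac1{2\delta}\|x-u\|^2,\qquad \vartheta(x,u)=\frac{\varphi(x,u)}{f(Kx)},$$ with $\vartheta(x,u)=+\infty$ where $\varphi(x,u)=+\infty$. Start from $x^0\in\mathcal S\cap\operatorname{dom}g$, $u^0\in\mathbb R^n$, $\theta_0=\vartheta(x^0,u^0)$, and for $k\ge0$ let $$y^{k+1}\in\partial f(Kx^k),\qquad x^{k+1}\in\operatorname*{arg\,min}_{x\in\mathcal S}\Big[g(x)+\tfrac1{2\delta}\big\|x-u^k+\delta\nabla h(x^k)-\theta_k\delta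 K^\top y^{k+1}\big\|^2\Big],$$ $$u^{k+1}=(1-\sigma)u^k+\sigma x^{k+1},\qquad \theta_{k+1}=\vartheta(x^{k+1},u^{k+1}).$$ For $m>0$ let $\varpi(x,y,u)=\dfrac{\varphi(x,u)}{\langle Kx,y\rangle-f^*(y)}$ if $y\in\operatorname{dom}f^*$ and $\langle Kx,y\rangle-f^*(y)>m/2$, and $\varpi(x,y,u)=+\infty$ otherwise. \textbf{Theorem (global convergence of FPSA).} Suppose that Assumptions 1 and 2 hold, that $(x^k,y^k,u^k,\theta_k)$ is generated by FPSA, and that one of the following holds: \begin{itemize} \item[(i)] $f^*$ is calm at $y^k$ for all sufficiently large $k$, and, for some $m$ with $0<m<\inf_k f(Kx^k)$, $\varpi$ has the KL property at every point of $\operatorname{dom}\partial\varpi$; \item[(ii)] $f$ is (finite and) differentiable with Lipschitz continuous gradient on an open set containing $K(\mathcal S)$, and $\vartheta$ has the KL property at every point of $\operatorname{dom}\partial\vartheta$. \end{itemize} Then $\sum_k\big(\|x^k-x^{k+1}\|+\|u^k-u^{k+1}\|\big)<+\infty$, and $x^k$ converges to a (limiting) lifted stationary point, i.e. a point $\bar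 x$ with $$0\in\big(\partial g(\bar x)+\nabla h(\bar x)+\partial\iota_{\mathcal S}(\bar x)\big)f(K\bar x)-\big(g(\bar x)+h(\bar x)\big)K^\top\partial f(K\bar x).$$ -/

import Mathlib

open Filter Topology

namespace FracProg

open scoped Pointwise

noncomputable section

/-- Euclidean space `ℝⁿ`. -/
abbrev E (n : ℕ) : Type := EuclideanSpace ℝ (Fin n)

/-! ### Extended-real-valued functions, modelled as functions into `EReal` -/

section General

variable {V : Type*} [NormedAddCommGroup V] [InnerProductSpace ℝ V]

/-- The effective domain `dom f = {x : f x < +∞}`. -/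
def edom (f : V → EReal) : Set V := {x | f x < ⊤}

/-- `f` is proper: it never takes the value `-∞` and is not identically `+∞`. -/
def IsProper (f : V → EReal) : Prop := (∀ x, f x ≠ ⊥) ∧ ∃ x, f x ≠ ⊤

/-- `f` is convex, i.e. its epigraph is a convex set. -/
def IsConvexFun (f : V → EReal) : Prop := Convex ℝ {q : V × ℝ | f q.1 ≤ (q.2 : EReal)}

open Classical in
/-- The indicator function `ι_S`: `0` on `S` and `+∞` off `S`. -/
def indicatorFun (S : Set V) (x : V) : EReal := if x ∈ S then 0 else ⊤

/-- The convex conjugate `f*(z) = sup_x (⟨x, z⟩ - f x)`. -/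
def conjugate (f : V → EReal) (z : V) : EReal := ⨆ x : V, (((inner ℝ x z : ℝ) : EReal) - f x)

/-- The Fréchet subdifferential of `f` at `a`, in its `o(‖x - a‖)` form: the lower limit of
`(f x - f a - ⟨v, x - a⟩) / ‖x - a‖` as `x → a`, `x ≠ a`, is nonnegative. It is empty where
`f` is not finite. -/
def frechetSubdiff (f : V → EReal) (a : V) : Set V :=
  {v | f a ≠ ⊤ ∧ f a ≠ ⊥ ∧ ∀ ε : ℝ, 0 < ε → ∀ᶠ x in 𝓝 a,
    f a + ((inner ℝ v (x - a) - ε * ‖x - a‖ : ℝ) : EReal) ≤ f x}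

/-- The limiting subdifferential of `f` at `a`. It is empty where `f` is not finite. -/
def limitingSubdiff (f : V → EReal) (a : V) : Set V :=
  {v | f a ≠ ⊤ ∧ f a ≠ ⊥ ∧ ∃ (xs vs : ℕ → V),
    Tendsto xs atTop (𝓝 a) ∧ Tendsto (fun k => f (xs k)) atTop (𝓝 (f a)) ∧
    (∀ k, vs k ∈ frechetSubdiff f (xs k)) ∧ Tendsto vs atTop (𝓝 v)}

/-- The Kurdyka–Łojasiewicz inequality for `f` at `a`, with desingularizing function `φ` on
`[0, r)`, `0 < r ≤ +∞`. The distance to the empty set is `+∞`. -/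
def KLAt (f : V → EReal) (a : V) : Prop :=
  ∃ (r : EReal) (U : Set V) (φ : ℝ → ℝ),
    0 < r ∧ U ∈ 𝓝 a ∧
    ContinuousOn φ {t : ℝ | 0 ≤ t ∧ (t : EReal) < r} ∧
    ConcaveOn ℝ {t : ℝ | 0 ≤ t ∧ (t : EReal) < r} φ ∧
    (∀ t : ℝ, 0 ≤ t → (t : EReal) < r → 0 ≤ φ t) ∧
    φ 0 = 0 ∧
    ContDiffOn ℝ 1 φ {t : ℝ | 0 < t ∧ (t : EReal) < r} ∧
    (∀ t : ℝ, 0 < t → (t : EReal) < r → 0 < deriv φ t) ∧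
    ∀ x ∈ U, f a < f x → f x < f a + r →
      1 ≤ ENNReal.ofReal (deriv φ (f x - f a).toReal) * Metric.infEDist 0 (limitingSubdiff f x)

/-- `f` has the KL property at every point of `dom ∂f`. -/
def HasKL (f : V → EReal) : Prop := ∀ a, (limitingSubdiff f a).Nonempty → KLAt f a

/-- `f` is calm at `a ∈ dom f`: `|f a - f z| ≤ ρ ‖a - z‖` for all `z` in a ball around `a`
(in particular `f` is finite on that ball). -/
def CalmAt (f : V → EReal) (a : V) : Prop :=
  f a ≠ ⊤ ∧ f a ≠ ⊥ ∧ ∃ ρ : ℝ, 0 < ρ ∧ ∃ ε : ℝ, 0 < ε ∧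
    ∀ z ∈ Metric.ball a ε, (f a - f z).abs ≤ ENNReal.ofReal (ρ * ‖a - z‖)

/-- A polyhedral set: the intersection of finitely many closed half-spaces. -/
def IsPolyhedral (S : Set V) : Prop :=
  ∃ A : Finset (V × ℝ), S = {x | ∀ q ∈ A, inner ℝ q.1 x ≤ q.2}

end General

/-! ### The fractional program `min_{x ∈ S} (g x + h x) / f (K x)` -/

variable {n p : ℕ}

/-- The standing assumptions on the data; `L` is a Lipschitz constant of `∇h` on an open set
containing `S`. -/
structure StandingAssumptions (S : Set (E n)) (g : E n → EReal) (h : E n → ℝ) (L : NNReal)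
    (f : E p → EReal) (K : E n →L[ℝ] E p) : Prop where
  nonempty_S : S.Nonempty
  convex_S : Convex ℝ S
  compact_S : IsCompact S
  proper_g : IsProper g
  convex_g : IsConvexFun g
  lsc_g : LowerSemicontinuous g
  smooth_h : ∃ O : Set (E n), IsOpen O ∧ S ⊆ O ∧ DifferentiableOn ℝ h O ∧
    LipschitzOnWith L (gradient h) O
  proper_f : IsProper f
  convex_f : IsConvexFun f
  lsc_f : LowerSemicontinuous f
  image_subset : K '' S ⊆ interior (edom f)
  pos_f : ∀ x ∈ S, 0 < f (K x)
  feasible : (S ∩ edom g).Nonempty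
  inf_nonneg : 0 ≤ ⨅ x ∈ S, (g x + (h x : EReal))

/-- The relative interior condition on `S` and `dom g` (`intrinsicInterior` is the relative
interior). -/
def QualificationCondition (S : Set (E n)) (g : E n → EReal) : Prop :=
  (intrinsicInterior ℝ S ∩ intrinsicInterior ℝ (edom g)).Nonempty ∨
    (IsPolyhedral S ∧ (S ∩ intrinsicInterior ℝ (edom g)).Nonempty)

/-- `φ(x, u; δ) = g x + h x + ι_S x + ‖x - u‖² / (2δ)`. -/
def phi (S : Set (E n)) (g : E n → EReal) (h : E n → ℝ) (δ : ℝ) (x u : E n) : EReal :=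
  g x + (h x : EReal) + indicatorFun S x + ((1 / (2 * δ) * ‖x - u‖ ^ 2 : ℝ) : EReal)

open Classical in
/-- `ϑ(x, u; δ) = φ(x, u; δ) / f (K x)`, with value `+∞` where `φ = +∞`, that is, for
`x ∉ S ∩ dom g`. -/
def vartheta (S : Set (E n)) (g : E n → EReal) (h : E n → ℝ) (f : E p → EReal)
    (K : E n →L[ℝ] E p) (δ : ℝ) (x u : E n) : EReal :=
  if phi S g h δ x u = ⊤ then ⊤ else phi S g h δ x u / f (K x)

open Classical in
/-- `ϖ(x, y, u) = φ(x, u; δ) / (⟨K x, y⟩ - f* y)` where `⟨K x, y⟩ - f* y > m / 2` (which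
includes `y ∈ dom f*`), and `+∞` elsewhere. -/
def varpi (S : Set (E n)) (g : E n → EReal) (h : E n → ℝ) (f : E p → EReal)
    (K : E n →L[ℝ] E p) (δ m : ℝ) (x : E n) (y : E p) (u : E n) : EReal :=
  if ((m / 2 : ℝ) : EReal) < ((inner ℝ (K x) y : ℝ) : EReal) - conjugate f y then
    phi S g h δ x u / (((inner ℝ (K x) y : ℝ) : EReal) - conjugate f y)
  else ⊤

/-- `ϑ` as a function on the Euclidean space `ℝⁿ × ℝⁿ`. -/
def varthetaFun (S : Set (E n)) (g : E n → EReal) (h : E n → ℝ) (f : E p → EReal)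
    (K : E n →L[ℝ] E p) (δ : ℝ) : WithLp 2 (E n × E n) → EReal :=
  fun w => vartheta S g h f K δ w.fst w.snd

/-- `ϖ` as a function on the Euclidean space `ℝⁿ × ℝᵖ × ℝⁿ`. -/
def varpiFun (S : Set (E n)) (g : E n → EReal) (h : E n → ℝ) (f : E p → EReal)
    (K : E n →L[ℝ] E p) (δ m : ℝ) : WithLp 2 (E n × WithLp 2 (E p × E n)) → EReal :=
  fun w => varpi S g h f K δ m w.fst w.snd.fst w.snd.snd

/-- The sequences `x, y, u, θ` are generated by the fully splitting proximal subgradient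
algorithm with step size `δ` and relaxation parameter `σ`, started at `x⁰ ∈ S ∩ dom g` and
`u⁰` with `θ₀ = ϑ(x⁰, u⁰; δ)`. The point `y⁰` is not used. -/
structure IsFPSA (S : Set (E n)) (g : E n → EReal) (h : E n → ℝ) (f : E p → EReal)
    (K : E n →L[ℝ] E p) (δ σ : ℝ) (x : ℕ → E n) (y : ℕ → E p) (u : ℕ → E n) (θ : ℕ → ℝ) :
    Prop where
  start : x 0 ∈ S ∩ edom g
  y_step : ∀ k, y (k + 1) ∈ limitingSubdiff f (K (x k))
  x_mem : ∀ k, x (k + 1) ∈ S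
  x_step : ∀ k, IsMinOn (fun z : E n => g z + ((1 / (2 * δ) *
    ‖z - u k + δ • gradient h (x k)
      - (θ k * δ) • (ContinuousLinearMap.adjoint K) (y (k + 1))‖ ^ 2 : ℝ) : EReal))
    S (x (k + 1))
  u_step : ∀ k, u (k + 1) = (1 - σ) • u k + σ • x (k + 1)
  theta_eq : ∀ k, (θ k : EReal) = vartheta S g h f K δ (x k) (u k)

/-- `a` is a (limiting) lifted stationary point:
`0 ∈ (∂g a + ∇h a + ∂ι_S a) f(K a) - (g a + h a) K* ∂f(K a)`. -/
def IsLiftedStationary (S : Set (E n)) (g : E n → EReal) (h : E n → ℝ) (f : E p → EReal)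
    (K : E n →L[ℝ] E p) (a : E n) : Prop :=
  (0 : E n) ∈ (f (K a)).toReal •
      (limitingSubdiff g a + {gradient h a} + limitingSubdiff (indicatorFun S) a)
    - (g a + (h a : EReal)).toReal •
      ((ContinuousLinearMap.adjoint K) '' limitingSubdiff f (K a))

/-- `f` is real-valued and differentiable with Lipschitz continuous gradient on some open set
containing `T`. -/
def SmoothNear (f : E p → EReal) (T : Set (E p)) : Prop :=
  ∃ O : Set (E p), IsOpen O ∧ T ⊆ O ∧ (∀ z ∈ O, f z ≠ ⊤ ∧ f z ≠ ⊥) ∧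
    DifferentiableOn ℝ (fun z => (f z).toReal) O ∧
    ∃ C : NNReal, LipschitzOnWith C (gradient fun z => (f z).toReal) O

end

end FracProg

open FracProg

/-! Finite length comes from three facts about a merit function along the iterates: sufficient
decrease, a subgradient controlled by the previous step, and the KL inequality. Write dₖ for
`stepLength x u k`. Testing the proximal step at xₖ, the descent lemma for `h` and the averaging in
`u` give φ(xₖ₊₁, uₖ₊₁) + c dₖ² ≤ θₖ ℓₖ (`IsFPSA.exists_descent`), where ℓₖ is the linearization of
`f` at K xₖ with slope yₖ₊₁, evaluated at K xₖ₊₁. Since ℓₖ ≤ f(K xₖ₊₁), θ drops by a multiple of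
dₖ².

In case (ii) the merit function is ϑ, with values θₖ. There yₖ₊₁ = ∇f(K xₖ) is Lipschitz in xₖ,
which bounds a Fréchet subgradient of ϑ by C (dₖ + θₖ - θₖ₊₁). In case (i) yₖ₊₁ need not depend
continuously on xₖ, and ϖ carries it as a variable. By equality in Fenchel–Young, ℓₖ is the
denominator of ϖ at (xₖ₊₁, yₖ₊₁), so the values rₖ of ϖ interlace with θ: θₖ₊₁ ≤ rₖ ≤ θₖ - c' dₖ².
The quotient rule `mem_frechetSubdiff_div` needs only an upper first-order estimate of the
denominator, supplied by Fenchel–Young, and its continuity, supplied by calmness.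

`HasKL.summable` turns these facts into ∑ dₖ < ∞, so xₖ converges. In the limit the proximal
inequality says that the limit minimizes g + ⟨c, ·⟩ over S with c = ∇h - ρ K*b, b a cluster point of
y and ρ = lim θₖ. The qualification condition splits -c into a subgradient of `g` and a normal to
`S`, by Lagrange multipliers for affine constraints (`exists_multipliers`). It is needed only there,
because the KL argument uses subgradients of the sum g + ι_S. -/

namespace FracProg

open scoped Pointwise

/-! ### Lagrange multipliers for affine constraints -/

section Multipliers

variable {V : Type*} [AddCommGroup V] [Module ℝ V]

/-- `a` is a point of `A` from which every segment of `A` ending in `a` can be prolonged. -/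
def IsCorePoint (A : Set V) (a : V) : Prop :=
  a ∈ A ∧ ∀ z ∈ A, ∃ ε : ℝ, 0 < ε ∧ a - ε • (z - a) ∈ A

/-- A segment from {l < 0} to {l > 0} meets {l = 0}, where `G` is nonnegative. Convexity turns this
into -G w / l w ≤ G z / (-l z), and any number separating the two families of ratios is a
multiplier. -/
theorem exists_multiplier_of_mixed_sign {D : Set V} {G : V → ℝ} (hG : ConvexOn ℝ D G)
    (l : V →ᵃ[ℝ] ℝ) (hpos : ∀ z ∈ D, l z = 0 → 0 ≤ G z)
    (hneg : ∃ z ∈ D, l z < 0) (hgt : ∃ z ∈ D, 0 < l z) :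
    ∃ c : ℝ, ∀ z ∈ D, 0 ≤ G z + c * l z := by
  have key : ∀ z ∈ D, ∀ w ∈ D, l z < 0 → 0 < l w → -G w / l w ≤ G z / (-l z) := by
    intro z hz w hw hlz hlw
    have hs : 0 < l w - l z := by linarith
    have hα : 0 ≤ l w / (l w - l z) := by positivity
    have hβ : 0 ≤ -l z / (l w - l z) := div_nonneg (by linarith) hs.le
    have hαβ : l w / (l w - l z) + -l z / (l w - l z) = 1 := by field_simp; ring
    have hmem := hG.1 hz hw hα hβ hαβ
    have hle := hG.2 hz hw hα hβ hαβ
    have hl0 : l ((l w / (l w - l z)) • z + (-l z / (l w - l z)) • w) = 0 := by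
      rw [Convex.combo_affine_apply hαβ]
      simp only [smul_eq_mul]
      field_simp
      ring
    have h0 := (hpos _ hmem hl0).trans hle
    simp only [smul_eq_mul] at h0
    have h1 : 0 ≤ l w * G z + -l z * G w := by
      have := mul_nonneg hs.le h0
      field_simp at this
      linarith
    rw [div_le_div_iff₀ hlw (by linarith)]
    nlinarith
  obtain ⟨z₁, hz₁, hl₁⟩ := hneg
  obtain ⟨z₂, hz₂, hl₂⟩ := hgt
  obtain ⟨c, hc₁, hc₂⟩ := exists_between_of_forall_le
    (s := (fun w => -G w / l w) '' {w ∈ D | 0 < l w})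
    (t := (fun z => G z / (-l z)) '' {z ∈ D | l z < 0})
    ⟨_, z₂, ⟨hz₂, hl₂⟩, rfl⟩ ⟨_, z₁, ⟨hz₁, hl₁⟩, rfl⟩ (by
      rintro _ ⟨w, ⟨hw, hlw⟩, rfl⟩ _ ⟨z, ⟨hz, hlz⟩, rfl⟩
      exact key z hz w hw hlz hlw)
  refine ⟨c, fun z hz => ?_⟩
  rcases lt_trichotomy (l z) 0 with hlz | hlz | hlz
  · have := hc₂ ⟨z, ⟨hz, hlz⟩, rfl⟩
    simp only at this
    rw [le_div_iff₀ (by linarith)] at this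
    linarith
  · simpa [hlz] using hpos z hz hlz
  · have := hc₁ ⟨z, ⟨hz, hlz⟩, rfl⟩
    simp only at this
    rw [div_le_iff₀ hlz] at this
    linarith

/-- A negative `c` from the equality-constrained case can be replaced by 0: it already forces G ≥ -c
l > 0 where l > 0. -/
theorem exists_multiplier_of_slater {D : Set V} {G : V → ℝ} (hG : ConvexOn ℝ D G)
    (l : V →ᵃ[ℝ] ℝ) (hpos : ∀ z ∈ D, l z ≤ 0 → 0 ≤ G z)
    (hneg : ∃ z ∈ D, l z < 0) : ∃ c : ℝ, 0 ≤ c ∧ ∀ z ∈ D, 0 ≤ G z + c * l z := by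
  by_cases hgt : ∃ z ∈ D, 0 < l z
  · obtain ⟨c, hc⟩ := exists_multiplier_of_mixed_sign hG l
      (fun z hz h0 => hpos z hz h0.le) hneg hgt
    by_cases hc0 : 0 ≤ c
    · exact ⟨c, hc0, hc⟩
    · refine ⟨0, le_rfl, fun z hz => ?_⟩
      rcases le_or_gt (l z) 0 with hlz | hlz
      · simpa using hpos z hz hlz
      · have := hc z hz
        nlinarith
  · push Not at hgt
    exact ⟨0, le_rfl, fun z hz => by simpa using hpos z hz (hgt z hz)⟩

/-- Prolonging a segment beyond the core point reverses the sign of `l`, so either `l` vanishes on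
`D` or it takes both signs. -/
theorem exists_multiplier_of_isCorePoint {D : Set V} {G : V → ℝ} (hG : ConvexOn ℝ D G)
    (l : V →ᵃ[ℝ] ℝ) {a : V} (ha : IsCorePoint D a) (hla : l a = 0)
    (hpos : ∀ z ∈ D, l z = 0 → 0 ≤ G z) : ∃ c : ℝ, ∀ z ∈ D, 0 ≤ G z + c * l z := by
  have refl : ∀ (z : V) (ε : ℝ), l (a - ε • (z - a)) = -ε * l z := by
    intro z ε
    have h := AffineMap.apply_lineMap l a z (-ε)
    rw [AffineMap.lineMap_apply_module', AffineMap.lineMap_apply_module', hla] at h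
    rw [show a - ε • (z - a) = -ε • (z - a) + a by module, h]
    simp
  by_cases hz : ∀ z ∈ D, l z = 0
  · exact ⟨0, fun z hzD => by simpa using hpos z hzD (hz z hzD)⟩
  · push Not at hz
    obtain ⟨z, hzD, hlz⟩ := hz
    obtain ⟨ε, hε, hmem⟩ := ha.2 z hzD
    rcases lt_or_gt_of_ne hlz with h | h
    · exact exists_multiplier_of_mixed_sign hG l hpos ⟨z, hzD, h⟩
        ⟨_, hmem, by rw [refl]; nlinarith⟩
    · exact exists_multiplier_of_mixed_sign hG l hpos
        ⟨_, hmem, by rw [refl]; nlinarith⟩ ⟨z, hzD, h⟩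

theorem convexOn_add_sum {ι : Type*} {D : Set V} {G : V → ℝ} (hG : ConvexOn ℝ D G)
    (l : ι → V →ᵃ[ℝ] ℝ) (c : ι → ℝ) (s : Finset ι) :
    ConvexOn ℝ D (fun z => G z + ∑ i ∈ s, c i * l i z) := by
  refine ⟨hG.1, fun x hx y hy α β hα hβ hαβ => ?_⟩
  have h1 := hG.2 hx hy hα hβ hαβ
  have h2 : ∑ i ∈ s, c i * l i (α • x + β • y)
      = α * ∑ i ∈ s, c i * l i x + β * ∑ i ∈ s, c i * l i y := by
    rw [Finset.mul_sum, Finset.mul_sum, ← Finset.sum_add_distrib]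
    refine Finset.sum_congr rfl fun i _ => ?_
    rw [Convex.combo_affine_apply hαβ]
    simp only [smul_eq_mul]
    ring
  simp only [smul_eq_mul] at h1 ⊢
  rw [h2]
  linarith

/-- Lagrange multipliers for a convex function under affine inequality constraints that are
satisfied at a core point of its domain. -/
theorem exists_multipliers {ι : Type*} (l : ι → V →ᵃ[ℝ] ℝ) (a : V) (s : Finset ι)
    (hla : ∀ i ∈ s, l i a ≤ 0) :
    ∀ (D : Set V) (G : V → ℝ), ConvexOn ℝ D G → IsCorePoint D a →
      (∀ z ∈ D, (∀ i ∈ s, l i z ≤ 0) → 0 ≤ G z) →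
      ∃ c : ι → ℝ, (∀ i, 0 ≤ c i) ∧ ∀ z ∈ D, 0 ≤ G z + ∑ i ∈ s, c i * l i z := by
  classical
  induction s using Finset.induction_on with
  | empty =>
    intro D G _ _ hpos
    exact ⟨fun _ => 0, fun _ => le_rfl, fun z hz => by simpa using hpos z hz (by simp)⟩
  | insert j s hj ih =>
    intro D G hG ha hpos
    have hla' : ∀ i ∈ s, l i a ≤ 0 := fun i hi => hla i (Finset.mem_insert_of_mem hi)
    have hlj : l j a ≤ 0 := hla j (Finset.mem_insert_self j s)
    have hsum : ∀ (c : ι → ℝ) (e : ℝ) (z : V),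
        ∑ i ∈ insert j s, (Function.update c j e) i * l i z
          = e * l j z + ∑ i ∈ s, c i * l i z := by
      intro c e z
      rw [Finset.sum_insert hj, Function.update_self]
      congr 1
      refine Finset.sum_congr rfl fun i hi => ?_
      rw [Function.update_of_ne (by rintro rfl; exact hj hi)]
    have hupd : ∀ (c : ι → ℝ) (e : ℝ), (∀ i, 0 ≤ c i) → 0 ≤ e →
        ∀ i, 0 ≤ (Function.update c j e) i := by
      intro c e hc he i
      by_cases hij : i = j
      · subst hij; simpa using he
      · simpa [hij] using hc i
    -- If constraint `j` can be strict on the set cut out by the others, its multiplier is found on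
    -- that set and `e * l j` is absorbed into the objective before the induction hypothesis is
    -- used.
    by_cases hsl : ∃ z ∈ D, (∀ i ∈ s, l i z ≤ 0) ∧ l j z < 0
    · obtain ⟨z₁, hz₁, hs₁, hj₁⟩ := hsl
      have hconv : Convex ℝ {z ∈ D | ∀ i ∈ s, l i z ≤ 0} := by
        intro x hx y hy α β hα hβ hαβ
        refine ⟨hG.1 hx.1 hy.1 hα hβ hαβ, fun i hi => ?_⟩
        rw [Convex.combo_affine_apply hαβ]
        simp only [smul_eq_mul]
        nlinarith [hx.2 i hi, hy.2 i hi]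
      obtain ⟨e, he, hpe⟩ := exists_multiplier_of_slater
        (D := {z ∈ D | ∀ i ∈ s, l i z ≤ 0}) (hG.subset (fun z hz => hz.1) hconv) (l j)
        (fun z hz hjz => hpos z hz.1 (by
          intro i hi
          rcases Finset.mem_insert.1 hi with rfl | hi
          · exact hjz
          · exact hz.2 i hi)) ⟨z₁, ⟨hz₁, hs₁⟩, hj₁⟩
      have hG' : ConvexOn ℝ D (fun z => G z + e * l j z) := by
        simpa using convexOn_add_sum hG l (fun _ => e) {j}
      obtain ⟨c, hc, hpc⟩ := ih hla' D (fun z => G z + e * l j z) hG' ha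
        (fun z hz hzs => hpe z ⟨hz, hzs⟩)
      refine ⟨Function.update c j e, hupd c e hc he, fun z hz => ?_⟩
      rw [hsum]
      have := hpc z hz
      linarith
    · push Not at hsl
      have haj : l j a = 0 := le_antisymm hlj (hsl a ha.1 hla')
      have hlconv : ConvexOn ℝ D (fun z => l j z) := by
        simpa using convexOn_add_sum (convexOn_const (0 : ℝ) hG.1) l (fun _ => 1) {j}
      -- Otherwise `l j` is itself nonnegative under the remaining constraints, so the induction
      -- hypothesis applies with `l j` as objective.
      obtain ⟨μ, hμ, hpμ⟩ := ih hla' D (fun z => l j z) hlconv ha hsl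
      -- A nonnegative affine function that vanishes at a core point vanishes on all of `D`.
      have hzero : ∀ z ∈ D, l j z + ∑ i ∈ s, μ i * l i z = 0 := by
        have hA : ∀ z, (l j + ∑ i ∈ s, μ i • l i : V →ᵃ[ℝ] ℝ) z
            = l j z + ∑ i ∈ s, μ i * l i z := by
          intro z
          have : ∀ t : Finset ι, (∑ i ∈ t, μ i • l i : V →ᵃ[ℝ] ℝ) z = ∑ i ∈ t, μ i * l i z := by
            intro t
            induction t using Finset.induction_on with
            | empty => simp
            | insert i t hi iht => simp [Finset.sum_insert hi, iht]
          simp [this]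
        have h0 : (l j + ∑ i ∈ s, μ i • l i : V →ᵃ[ℝ] ℝ) a = 0 := by
          have h1 := hpμ a ha.1
          have h2 : ∑ i ∈ s, μ i * l i a ≤ 0 :=
            Finset.sum_nonpos fun i hi => mul_nonpos_of_nonneg_of_nonpos (hμ i) (hla' i hi)
          rw [hA]
          linarith
        intro z hz
        obtain ⟨ε, hε, hmem⟩ := ha.2 z hz
        have h1 := hpμ _ hmem
        have h2 := hpμ z hz
        have h := AffineMap.apply_lineMap (l j + ∑ i ∈ s, μ i • l i : V →ᵃ[ℝ] ℝ) a z (-ε)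
        rw [AffineMap.lineMap_apply_module', AffineMap.lineMap_apply_module', h0, hA, hA,
          show -ε • (z - a) + a = a - ε • (z - a) by module] at h
        rw [h] at h1
        simp only [sub_zero, smul_eq_mul, add_zero] at h1
        nlinarith
      have ha' : IsCorePoint {z ∈ D | l j z = 0} a := by
        refine ⟨⟨ha.1, haj⟩, fun z hz => ?_⟩
        obtain ⟨ε, hε, hmem⟩ := ha.2 z hz.1
        refine ⟨ε, hε, hmem, ?_⟩
        have h := AffineMap.apply_lineMap (l j) a z (-ε)
        rw [AffineMap.lineMap_apply_module', AffineMap.lineMap_apply_module', haj, hz.2] at h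
        rw [show a - ε • (z - a) = -ε • (z - a) + a by module, h]
        simp
      have hconv : Convex ℝ {z ∈ D | l j z = 0} := by
        intro x hx y hy α β hα hβ hαβ
        refine ⟨hG.1 hx.1 hy.1 hα hβ hαβ, ?_⟩
        rw [Convex.combo_affine_apply hαβ, hx.2, hy.2]
        simp
      obtain ⟨ν, hν, hpν⟩ := ih hla' {z ∈ D | l j z = 0} G
        (hG.subset (fun z hz => hz.1) hconv) ha' (fun z hz hzs => hpos z hz.1 (by
          intro i hi
          rcases Finset.mem_insert.1 hi with rfl | hi
          · exact hz.2.le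
          · exact hzs i hi))
      obtain ⟨e, he⟩ := exists_multiplier_of_isCorePoint (convexOn_add_sum hG l ν s) (l j) ha haj
        (fun z hz h0 => hpν z ⟨hz, h0⟩)
      by_cases he0 : 0 ≤ e
      · refine ⟨Function.update ν j e, hupd ν e hν he0, fun z hz => ?_⟩
        rw [hsum]
        have := he z hz
        linarith
      · push Not at he0
        -- A negative `e` is removed with `hzero`: on `D`, e l_j = ∑ (-e μ_i) l_i, and these
        -- coefficients are nonnegative.
        refine ⟨Function.update (fun i => ν i + -e * μ i) j 0,
          hupd _ 0 (fun i => by nlinarith [hν i, hμ i]) le_rfl, fun z hz => ?_⟩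
        rw [hsum]
        have h1 := he z hz
        have h2 := hzero z hz
        have h3 : ∑ i ∈ s, (ν i + -e * μ i) * l i z
            = ∑ i ∈ s, ν i * l i z + -e * ∑ i ∈ s, μ i * l i z := by
          rw [Finset.mul_sum, ← Finset.sum_add_distrib]
          exact Finset.sum_congr rfl fun i _ => by ring
        rw [h3]
        have h4 : ∑ i ∈ s, μ i * l i z = -l j z := by linarith
        rw [h4]
        linarith

end Multipliers

theorem isCorePoint_of_mem_intrinsicInterior {V : Type*} [NormedAddCommGroup V]
    [NormedSpace ℝ V] {A : Set V} {a : V} (ha : a ∈ intrinsicInterior ℝ A) :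
    IsCorePoint A a := by
  refine ⟨intrinsicInterior_subset ha, fun z hz => ?_⟩
  obtain ⟨a', ha', rfl⟩ := ha
  have hzs : z ∈ affineSpan ℝ A := subset_affineSpan ℝ A hz
  have hmem : ∀ t : ℝ, (a' : V) - t • (z - a') ∈ affineSpan ℝ A := by
    intro t
    have := AffineMap.lineMap_mem (-t) a'.2 hzs
    rw [AffineMap.lineMap_apply_module'] at this
    rwa [show (a' : V) - t • (z - a') = -t • (z - a') + a' by module]
  let γ : ℝ → affineSpan ℝ A := fun t => ⟨(a' : V) - t • (z - a'), hmem t⟩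
  have hγ : Continuous γ := by
    apply Continuous.subtype_mk
    fun_prop
  have hγ0 : γ 0 = a' := by
    apply Subtype.ext
    simp [γ]
  have hev : ∀ᶠ t in 𝓝 (0 : ℝ), γ t ∈ interior ((↑) ⁻¹' A : Set (affineSpan ℝ A)) :=
    hγ.continuousAt.eventually_mem (by rw [hγ0]; exact isOpen_interior.mem_nhds ha')
  obtain ⟨ε, hε, hb⟩ := Metric.eventually_nhds_iff.1 hev
  refine ⟨ε / 2, by positivity, ?_⟩
  have := interior_subset (hb (y := ε / 2) (by
    rw [Real.dist_eq, sub_zero, abs_of_pos (by positivity)]; linarith))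
  exact this

/-! ### Convex functions with values in `EReal` and their subgradients -/

section ExtendedReal

theorem IsProper.coe_toReal {V : Type*} {f : V → EReal} (hf : IsProper f) {a : V}
    (ha : f a ≠ ⊤) :
    ((f a).toReal : EReal) = f a :=
  EReal.coe_toReal ha (hf.1 a)

variable {V : Type*} [NormedAddCommGroup V] [InnerProductSpace ℝ V] {f : V → EReal}

theorem IsConvexFun.convexOn_toReal (hc : IsConvexFun f) (hf : IsProper f) :
    ConvexOn ℝ (edom f) (fun x => (f x).toReal) := by
  have key : ∀ x ∈ edom f, ∀ y ∈ edom f, ∀ α β : ℝ, 0 ≤ α → 0 ≤ β → α + β = 1 →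
      f (α • x + β • y) ≤ ((α * (f x).toReal + β * (f y).toReal : ℝ) : EReal) := by
    intro x hx y hy α β hα hβ hαβ
    have hx' : (x, (f x).toReal) ∈ {q : V × ℝ | f q.1 ≤ (q.2 : EReal)} :=
      (hf.coe_toReal (ne_of_lt hx)).ge
    have hy' : (y, (f y).toReal) ∈ {q : V × ℝ | f q.1 ≤ (q.2 : EReal)} :=
      (hf.coe_toReal (ne_of_lt hy)).ge
    exact hc hx' hy' hα hβ hαβ
  refine ⟨fun x hx y hy α β hα hβ hαβ => ?_, fun x hx y hy α β hα hβ hαβ => ?_⟩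
  · exact (key x hx y hy α β hα hβ hαβ).trans_lt (EReal.coe_lt_top _)
  · have h := key x hx y hy α β hα hβ hαβ
    have h2 : f (α • x + β • y) ≠ ⊤ := ne_of_lt (h.trans_lt (EReal.coe_lt_top _))
    rw [← hf.coe_toReal h2] at h
    exact EReal.coe_le_coe_iff.1 h

theorem frechetSubdiff_subset_limitingSubdiff (f : V → EReal) (a : V) :
    frechetSubdiff f a ⊆ limitingSubdiff f a := fun v hv =>
  ⟨hv.1, hv.2.1, fun _ => a, fun _ => v, tendsto_const_nhds, tendsto_const_nhds,
    fun _ => hv, tendsto_const_nhds⟩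

theorem mem_limitingSubdiff_of_forall_le {a v : V} (h1 : f a ≠ ⊤) (h2 : f a ≠ ⊥)
    (h : ∀ z, f a + ((inner ℝ v (z - a) : ℝ) : EReal) ≤ f z) : v ∈ limitingSubdiff f a := by
  apply frechetSubdiff_subset_limitingSubdiff
  refine ⟨h1, h2, fun ε hε => Eventually.of_forall fun z => le_trans ?_ (h z)⟩
  have : 0 ≤ ε * ‖z - a‖ := by positivity
  gcongr
  linarith

theorem IsProper.mem_limitingSubdiff (hf : IsProper f) {a v : V} (h1 : f a ≠ ⊤)
    (h : ∀ z ∈ edom f, (f a).toReal + inner ℝ v (z - a) ≤ (f z).toReal) :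
    v ∈ limitingSubdiff f a := by
  refine mem_limitingSubdiff_of_forall_le h1 (hf.1 a) fun z => ?_
  by_cases hz : f z = ⊤
  · rw [hz]; exact le_top
  · rw [← hf.coe_toReal h1, ← hf.coe_toReal hz]
    exact_mod_cast h z (lt_top_iff_ne_top.2 hz)

theorem mem_limitingSubdiff_indicatorFun {S : Set V} {a v : V} (ha : a ∈ S)
    (h : ∀ z ∈ S, inner ℝ v (z - a) ≤ (0 : ℝ)) : v ∈ limitingSubdiff (indicatorFun S) a := by
  have h0 : indicatorFun S a = 0 := by simp [indicatorFun, ha]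
  refine mem_limitingSubdiff_of_forall_le (by simp [h0]) (by simp [h0]) fun z => ?_
  rw [h0, zero_add]
  by_cases hz : z ∈ S
  · simpa [indicatorFun, hz] using h z hz
  · simp [indicatorFun, hz]

/-- A one-variable inequality `0 ≤ A t + ε t` near `0⁺` for all `ε > 0` forces `0 ≤ A`. -/
theorem nonneg_of_forall_pos_add {A B : ℝ} (hB : 0 ≤ B) (h : ∀ ε : ℝ, 0 < ε → 0 ≤ A + ε * B) :
    0 ≤ A := by
  refine le_of_forall_pos_le_add fun ε hε => ?_
  have h1 := h (ε / (B + 1)) (by positivity)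
  have h2 : ε / (B + 1) * B ≤ ε := by
    rw [div_mul_eq_mul_div, div_le_iff₀ (by positivity)]
    nlinarith
  linarith

/-- The local inequality at a + t (z - a) is compared with the convexity bound there and divided by
t; the error ε ‖z - a‖ is arbitrary. -/
theorem IsConvexFun.le_of_mem_frechetSubdiff (hc : IsConvexFun f) (hf : IsProper f) {a v : V}
    (hv : v ∈ frechetSubdiff f a) {z : V} (hz : z ∈ edom f) :
    (f a).toReal + inner ℝ v (z - a) ≤ (f z).toReal := by
  obtain ⟨h1, -, hv⟩ := hv
  have hconv := hc.convexOn_toReal hf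
  have haD : a ∈ edom f := lt_top_iff_ne_top.2 h1
  suffices 0 ≤ (f z).toReal - (f a).toReal - inner ℝ v (z - a) by linarith
  refine nonneg_of_forall_pos_add (norm_nonneg (z - a)) fun ε hε => ?_
  have hpath : Tendsto (fun t : ℝ => a + t • (z - a)) (𝓝[>] 0) (𝓝 a) := by
    have : Tendsto (fun t : ℝ => a + t • (z - a)) (𝓝 0) (𝓝 (a + (0 : ℝ) • (z - a))) :=
      Continuous.tendsto (by fun_prop) 0
    rw [zero_smul, add_zero] at this
    exact this.mono_left nhdsWithin_le_nhds
  obtain ⟨t, ht1, ht2⟩ := ((hpath.eventually (hv ε hε)).and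
    (Ioo_mem_nhdsGT (zero_lt_one' ℝ))).exists
  have e1 : a + t • (z - a) = (1 - t) • a + t • z := by module
  have hmem : a + t • (z - a) ∈ edom f := by
    rw [e1]
    exact hconv.1 haD hz (by linarith [ht2.2]) ht2.1.le (by ring)
  have h3 := hconv.2 haD hz (by linarith [ht2.2] : (0 : ℝ) ≤ 1 - t) ht2.1.le (by ring)
  rw [← e1] at h3
  rw [← hf.coe_toReal h1, ← hf.coe_toReal (ne_of_lt hmem), ← EReal.coe_add,
    EReal.coe_le_coe_iff, add_sub_cancel_left, inner_smul_right, norm_smul,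
    Real.norm_of_nonneg ht2.1.le] at ht1
  simp only [smul_eq_mul] at h3
  have h4 : 0 ≤ t * ((f z).toReal - (f a).toReal - inner ℝ v (z - a) + ε * ‖z - a‖) := by
    nlinarith
  exact nonneg_of_mul_nonneg_right h4 ht2.1

/-- Limiting subgradients of a proper convex function are global subgradients. -/
theorem IsConvexFun.le_of_mem_limitingSubdiff (hc : IsConvexFun f) (hf : IsProper f) {a v : V}
    (hv : v ∈ limitingSubdiff f a) {z : V} (hz : z ∈ edom f) :
    (f a).toReal + inner ℝ v (z - a) ≤ (f z).toReal := by
  obtain ⟨h1, h2, xs, vs, hx, hfx, hvx, hvs⟩ := hv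
  have hlim : Tendsto (fun k => (f (xs k)).toReal + inner ℝ (vs k) (z - xs k)) atTop
      (𝓝 ((f a).toReal + inner ℝ v (z - a))) :=
    ((EReal.tendsto_toReal h1 h2).comp hfx).add (hvs.inner (tendsto_const_nhds.sub hx))
  exact le_of_tendsto hlim (Eventually.of_forall fun k =>
    hc.le_of_mem_frechetSubdiff hf (hvx k) hz)

/-- Subgradient inequality for a constrained proximal minimizer. -/
theorem IsConvexFun.le_of_isMinOn_prox (hc : IsConvexFun f) (hf : IsProper f) {S : Set V}
    (hS : Convex ℝ S) {δ : ℝ} (hδ : 0 < δ) {q a : V} (haS : a ∈ S) (ha : f a ≠ ⊤)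
    (hmin : IsMinOn (fun z => f z + ((1 / (2 * δ) * ‖z - q‖ ^ 2 : ℝ) : EReal)) S a)
    {z : V} (hzS : z ∈ S) (hz : f z ≠ ⊤) :
    (f a).toReal + inner ℝ ((1 / δ) • (q - a)) (z - a) ≤ (f z).toReal := by
  have hconv := hc.convexOn_toReal hf
  have haD : a ∈ edom f := lt_top_iff_ne_top.2 ha
  have hzD : z ∈ edom f := lt_top_iff_ne_top.2 hz
  suffices 0 ≤ (f z).toReal - (f a).toReal - inner ℝ ((1 / δ) • (q - a)) (z - a) by linarith
  refine nonneg_of_forall_pos_add (B := 1 / (2 * δ) * ‖z - a‖ ^ 2) (by positivity)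
    fun ε hε => ?_
  -- Minimality is tested on the segment from `a` to `z`. After division by `t` the quadratic term
  -- still carries a factor t ≤ ε and plays the role of the error.
  set t := min ε 1 with ht
  have ht0 : 0 < t := lt_min hε one_pos
  have ht1 : t ≤ 1 := min_le_right _ _
  have htε : t ≤ ε := min_le_left _ _
  have e1 : a + t • (z - a) = (1 - t) • a + t • z := by module
  have hmem : a + t • (z - a) ∈ edom f := by
    rw [e1]; exact hconv.1 haD hzD (by linarith) ht0.le (by ring)
  have hmemS : a + t • (z - a) ∈ S := by
    rw [e1]; exact hS haS hzS (by linarith) ht0.le (by ring)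
  have h3 := hconv.2 haD hzD (by linarith : (0 : ℝ) ≤ 1 - t) ht0.le (by ring)
  rw [← e1] at h3
  have h4 := isMinOn_iff.1 hmin _ hmemS
  rw [← hf.coe_toReal ha, ← hf.coe_toReal (ne_of_lt hmem), ← EReal.coe_add, ← EReal.coe_add,
    EReal.coe_le_coe_iff] at h4
  have h5 : ‖a + t • (z - a) - q‖ ^ 2
      = ‖a - q‖ ^ 2 - 2 * t * inner ℝ (q - a) (z - a) + t ^ 2 * ‖z - a‖ ^ 2 := by
    rw [show a + t • (z - a) - q = t • (z - a) - (q - a) by abel, norm_sub_sq_real,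
      norm_smul, Real.norm_of_nonneg ht0.le, inner_smul_left, real_inner_comm,
      norm_sub_rev q a]
    simp
    ring
  rw [h5] at h4
  simp only [smul_eq_mul] at h3
  rw [inner_smul_left]
  simp only [RCLike.conj_to_real]
  have h6 : 0 ≤ t * ((f z).toReal - (f a).toReal - 1 / δ * inner ℝ (q - a) (z - a)
      + t * (1 / (2 * δ) * ‖z - a‖ ^ 2)) := by
    have e2 : 1 / δ = 2 * (1 / (2 * δ)) := by field_simp
    rw [e2]
    nlinarith
  have h7 := nonneg_of_mul_nonneg_right h6 ht0
  have h8 : t * (1 / (2 * δ) * ‖z - a‖ ^ 2) ≤ ε * (1 / (2 * δ) * ‖z - a‖ ^ 2) := by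
    gcongr
  linarith

end ExtendedReal

/-! ### Splitting optimality over `S` into a subgradient and a normal -/

section SumRule

variable {n : ℕ}

/-- The variable is doubled: on S × dom g the constraint s = z is affine, and a common relative
interior point gives a core point on the diagonal. The multiplier vector `v` of s = z separates the
two subgradients, found by freezing s = a and then z = a. -/
theorem exists_subgradient_add_normal_of_intrinsicInterior {S : Set (E n)} {g : E n → EReal}
    (hS : Convex ℝ S) (hg : IsProper g) (hc : IsConvexFun g)
    (hri : (intrinsicInterior ℝ S ∩ intrinsicInterior ℝ (edom g)).Nonempty)
    {a c : E n} (haS : a ∈ S) (ha : g a ≠ ⊤)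
    (hmin : ∀ z ∈ S, g z ≠ ⊤ → (g a).toReal ≤ (g z).toReal + inner ℝ c (z - a)) :
    ∃ ξ η : E n, (∀ z ∈ edom g, (g a).toReal + inner ℝ ξ (z - a) ≤ (g z).toReal) ∧
      (∀ z ∈ S, inner ℝ η (z - a) ≤ (0 : ℝ)) ∧ ξ + η = -c := by
  obtain ⟨x₀, hx₁, hx₂⟩ := hri
  have core₁ := isCorePoint_of_mem_intrinsicInterior hx₁
  have core₂ := isCorePoint_of_mem_intrinsicInterior hx₂
  have hconv := hc.convexOn_toReal hg
  -- Each coordinate of s = z is encoded as two inequalities, with normals ±eᵢ.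
  let e : Fin n ⊕ Fin n → E n := Sum.elim (fun i => EuclideanSpace.single i 1)
    (fun i => -EuclideanSpace.single i 1)
  let l : Fin n ⊕ Fin n → (E n × E n) →ᵃ[ℝ] ℝ := fun i =>
    ((innerSL ℝ (e i)).toLinearMap ∘ₗ
      (LinearMap.fst ℝ (E n) (E n) - LinearMap.snd ℝ (E n) (E n))).toAffineMap
  have hl : ∀ i w, l i w = inner ℝ (e i) (w.1 - w.2) := fun i w => rfl
  have hG : ConvexOn ℝ (S ×ˢ edom g)
      (fun w : E n × E n => (g w.2).toReal + inner ℝ c (w.2 - a) - (g a).toReal) := by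
    refine ⟨hS.prod hconv.1, fun x hx y hy α β hα hβ hαβ => ?_⟩
    have h1 := hconv.2 hx.2 hy.2 hα hβ hαβ
    simp only [smul_eq_mul, Prod.snd_add, Prod.smul_snd, inner_sub_right, inner_add_right,
      inner_smul_right] at h1 ⊢
    have : β = 1 - α := by linarith
    subst this
    nlinarith
  have hcore : IsCorePoint (S ×ˢ edom g) (x₀, x₀) := by
    refine ⟨⟨core₁.1, core₂.1⟩, ?_⟩
    have shrink : ∀ {A : Set (E n)}, Convex ℝ A → x₀ ∈ A → ∀ z (ε ε' : ℝ), 0 < ε' → ε' ≤ ε →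
        x₀ - ε • (z - x₀) ∈ A → x₀ - ε' • (z - x₀) ∈ A := by
      intro A hA hx z ε ε' h0 hle hm
      have hε : 0 < ε := h0.trans_le hle
      have h1 : 0 ≤ 1 - ε' / ε := by
        rw [sub_nonneg, div_le_one hε]; exact hle
      have h := hA hx hm h1 (by positivity : 0 ≤ ε' / ε) (by ring)
      convert h using 1
      rw [smul_sub (ε' / ε), smul_smul, div_mul_cancel₀ _ hε.ne']
      module
    rintro ⟨s, z⟩ ⟨hs, hz⟩
    obtain ⟨ε₁, h₁, hm₁⟩ := core₁.2 s hs
    obtain ⟨ε₂, h₂, hm₂⟩ := core₂.2 z hz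
    -- One `ε` must serve both factors; by convexity a prolongation may be shortened.
    exact ⟨min ε₁ ε₂, lt_min h₁ h₂,
      shrink hS core₁.1 s _ _ (lt_min h₁ h₂) (min_le_left _ _) hm₁,
      shrink hconv.1 core₂.1 z _ _ (lt_min h₁ h₂) (min_le_right _ _) hm₂⟩
  obtain ⟨μ, -, hμ⟩ := exists_multipliers l (x₀, x₀) Finset.univ (fun i _ => by simp [hl])
    _ _ hG hcore (by
      rintro ⟨s, z⟩ ⟨hs, hz⟩ hle
      have hsz : s = z := by
        ext i
        have h1 := hle (Sum.inl i) (Finset.mem_univ _)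
        have h2 := hle (Sum.inr i) (Finset.mem_univ _)
        simp only [hl, e, Sum.elim_inl, Sum.elim_inr, inner_neg_left,
          EuclideanSpace.inner_single_left] at h1 h2
        simp at h1 h2
        linarith
      subst hsz
      have := hmin s hs (ne_of_lt hz)
      simp only
      linarith)
  set v : E n := ∑ i, μ i • e i with hv
  have hμ' : ∀ s ∈ S, ∀ z ∈ edom g,
      0 ≤ (g z).toReal + inner ℝ c (z - a) - (g a).toReal + inner ℝ v (s - z) := by
    intro s hs z hz
    have h := hμ (s, z) ⟨hs, hz⟩
    simpa only [hl, hv, sum_inner, inner_smul_left, RCLike.conj_to_real] using h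
  refine ⟨v - c, -v, fun z hz => ?_, fun s hs => ?_, by abel⟩
  · have h := hμ' a haS z hz
    rw [← neg_sub z a, inner_neg_right] at h
    rw [inner_sub_left]
    linarith
  · have h := hμ' s hs a (lt_top_iff_ne_top.2 ha)
    rw [sub_self, inner_zero_right] at h
    rw [inner_neg_left]
    linarith

/-- The half-spaces of `S` serve directly as affine constraints on dom g, so only a relative
interior point of dom g lying in `S` is needed. The normal vector is the multiplier combination of
the facet normals. -/
theorem exists_subgradient_add_normal_of_isPolyhedral {S : Set (E n)} {g : E n → EReal}
    (hg : IsProper g) (hc : IsConvexFun g) (hS : IsPolyhedral S)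
    (hri : (S ∩ intrinsicInterior ℝ (edom g)).Nonempty)
    {a c : E n} (haS : a ∈ S) (ha : g a ≠ ⊤)
    (hmin : ∀ z ∈ S, g z ≠ ⊤ → (g a).toReal ≤ (g z).toReal + inner ℝ c (z - a)) :
    ∃ ξ η : E n, (∀ z ∈ edom g, (g a).toReal + inner ℝ ξ (z - a) ≤ (g z).toReal) ∧
      (∀ z ∈ S, inner ℝ η (z - a) ≤ (0 : ℝ)) ∧ ξ + η = -c := by
  obtain ⟨x₀, hx₁, hx₂⟩ := hri
  obtain ⟨A, rfl⟩ := hS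
  have core₂ := isCorePoint_of_mem_intrinsicInterior hx₂
  have hconv := hc.convexOn_toReal hg
  let l : E n × ℝ → E n →ᵃ[ℝ] ℝ := fun q =>
    (innerSL ℝ q.1).toLinearMap.toAffineMap - AffineMap.const ℝ (E n) q.2
  have hl : ∀ q w, l q w = inner ℝ q.1 w - q.2 := fun q w => rfl
  have hG : ConvexOn ℝ (edom g) (fun z => (g z).toReal + inner ℝ c (z - a) - (g a).toReal) := by
    refine ⟨hconv.1, fun x hx y hy α β hα hβ hαβ => ?_⟩
    have h1 := hconv.2 hx hy hα hβ hαβ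
    simp only [smul_eq_mul, inner_sub_right, inner_add_right, inner_smul_right] at h1 ⊢
    have : β = 1 - α := by linarith
    subst this
    nlinarith
  obtain ⟨μ, hμ0, hμ⟩ := exists_multipliers l x₀ A (fun q hq => by
      rw [hl]; exact sub_nonpos.2 (hx₁ q hq)) _ _ hG core₂ (by
      intro z hz hle
      have := hmin z (fun q hq => sub_nonpos.1 (hle q hq)) (ne_of_lt hz)
      linarith)
  have hterm : ∀ z, (∀ q ∈ A, inner ℝ q.1 z ≤ q.2) → ∑ q ∈ A, μ q * l q z ≤ 0 := fun z hz =>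
    Finset.sum_nonpos fun q hq =>
      mul_nonpos_of_nonneg_of_nonpos (hμ0 q) (sub_nonpos.2 (hz q hq))
  -- Complementary slackness: the multiplier inequality at `a` and feasibility of `a` give opposite
  -- signs.
  have hzero : ∑ q ∈ A, μ q * l q a = 0 := by
    have h1 := hμ a (lt_top_iff_ne_top.2 ha)
    rw [sub_self, inner_zero_right] at h1
    have h2 := hterm a haS
    linarith
  have hη : ∀ z, inner ℝ (∑ q ∈ A, μ q • q.1) (z - a) = ∑ q ∈ A, μ q * l q z := by
    intro z
    rw [← sub_zero (∑ q ∈ A, μ q * l q z), ← hzero, ← Finset.sum_sub_distrib, sum_inner]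
    refine Finset.sum_congr rfl fun q _ => ?_
    rw [inner_smul_left, inner_sub_right, hl, hl]
    simp only [RCLike.conj_to_real]
    ring
  refine ⟨-c - ∑ q ∈ A, μ q • q.1, ∑ q ∈ A, μ q • q.1, fun z hz => ?_, fun z hz => ?_, by abel⟩
  · have h := hμ z hz
    rw [← hη] at h
    rw [inner_sub_left, inner_neg_left]
    linarith
  · rw [hη]
    exact hterm z hz

/-- The subdifferential sum rule for `g + ι_S`, in the form of an optimality condition. -/
theorem QualificationCondition.exists_subgradient_add_normal {S : Set (E n)} {g : E n → EReal}
    (hQ : QualificationCondition S g) (hS : Convex ℝ S) (hg : IsProper g) (hc : IsConvexFun g)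
    {a c : E n} (haS : a ∈ S) (ha : g a ≠ ⊤)
    (hmin : ∀ z ∈ S, g z ≠ ⊤ → (g a).toReal ≤ (g z).toReal + inner ℝ c (z - a)) :
    ∃ ξ ∈ limitingSubdiff g a, ∃ η ∈ limitingSubdiff (indicatorFun S) a, ξ + η = -c := by
  have : ∃ ξ η : E n, (∀ z ∈ edom g, (g a).toReal + inner ℝ ξ (z - a) ≤ (g z).toReal) ∧
      (∀ z ∈ S, inner ℝ η (z - a) ≤ (0 : ℝ)) ∧ ξ + η = -c := by
    rcases hQ with hri | ⟨hP, hri⟩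
    · exact exists_subgradient_add_normal_of_intrinsicInterior hS hg hc hri haS ha hmin
    · exact exists_subgradient_add_normal_of_isPolyhedral hg hc hP hri haS ha hmin
  obtain ⟨ξ, η, hξ, hη, hsum⟩ := this
  exact ⟨ξ, hg.mem_limitingSubdiff ha hξ, η, mem_limitingSubdiff_indicatorFun haS hη, hsum⟩

end SumRule

/-! ### Finite length from the KL inequality -/

section KL

/-- Finite length from a sufficient decrease condition, a relative error condition and a
desingularizing function `φ`, of which only the tangent inequality (with slopes `D`) matters. -/
theorem summable_of_desingularizing {r d : ℕ → ℝ} {c C r₀ : ℝ} {φ D : ℝ → ℝ} (hc : 0 < c)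
    (hC : 0 ≤ C) (hd : ∀ k, 0 ≤ d k) (hr : ∀ k, 0 ≤ r k) (hr₀ : ∀ k, r k < r₀)
    (hdec : ∀ k, r (k + 1) + c * d k ^ 2 ≤ r k)
    (hφ : ∀ t, 0 ≤ t → t < r₀ → 0 ≤ φ t)
    (hD : ∀ t, 0 < t → t < r₀ → 0 < D t)
    (htan : ∀ s t, 0 ≤ s → s ≤ t → 0 < t → t < r₀ → φ s + D t * (t - s) ≤ φ t)
    (hKL : ∀ k, 0 < r (k + 1) → 1 ≤ D (r (k + 1)) * (C * (d k + (r k - r (k + 1))))) :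
    Summable d := by
  have hanti : ∀ k, r (k + 1) ≤ r k := fun k => by
    have := hdec k
    nlinarith [mul_nonneg hc.le (sq_nonneg (d k))]
  have step : ∀ k, d (k + 1) ≤
      C / c * (φ (r (k + 1)) - φ (r (k + 2))) + (d k + (r k - r (k + 1))) / 4 := by
    intro k
    have hs : 0 ≤ d k + (r k - r (k + 1)) := by linarith [hd k, hanti k]
    have hdk := hdec (k + 1)
    rw [show k + 1 + 1 = k + 2 from rfl] at hdk
    rcases (hr (k + 1)).eq_or_lt with h0 | h0
    · have h1 : r (k + 2) = r (k + 1) := by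
        have h2 : r (k + 2) ≤ r (k + 1) := hanti (k + 1)
        linarith [hr (k + 2)]
      have h2 : d (k + 1) ^ 2 ≤ 0 := by
        by_contra hcon
        push Not at hcon
        nlinarith [mul_pos hc hcon]
      have h3 : d (k + 1) = 0 := by
        exact pow_eq_zero_iff (two_ne_zero) |>.1 (le_antisymm h2 (sq_nonneg _))
      rw [h1, h3]
      simp only [sub_self, mul_zero, zero_add]
      positivity
    · set s := d k + (r k - r (k + 1)) with hsdef
      set A := φ (r (k + 1)) - φ (r (k + 2)) with hA
      have h1 := htan (r (k + 2)) (r (k + 1)) (hr _) (hanti (k + 1)) h0 (hr₀ _)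
      have hDp := hD _ h0 (hr₀ (k + 1))
      have h2 : D (r (k + 1)) * (c * d (k + 1) ^ 2) ≤ A := by
        have : D (r (k + 1)) * (c * d (k + 1) ^ 2) ≤
            D (r (k + 1)) * (r (k + 1) - r (k + 2)) :=
          mul_le_mul_of_nonneg_left (by linarith) hDp.le
        linarith
      have h3 : c * d (k + 1) ^ 2 ≤ A * (C * s) := by
        have h4 := hKL k h0
        have h5 : 0 ≤ c * d (k + 1) ^ 2 := by positivity
        calc c * d (k + 1) ^ 2 ≤ c * d (k + 1) ^ 2 * (D (r (k + 1)) * (C * s)) :=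
              le_mul_of_one_le_right h5 h4
          _ = D (r (k + 1)) * (c * d (k + 1) ^ 2) * (C * s) := by ring
          _ ≤ A * (C * s) := mul_le_mul_of_nonneg_right h2 (by positivity)
      have hA0 : 0 ≤ A := le_trans (by positivity) h2
      -- From d² ≤ (C/c) A s, AM–GM in the form a s ≤ (a + s/4)². The weight 1/4 on `s` lets the sum
      -- of the d's be absorbed below.
      have h4 : d (k + 1) ^ 2 ≤ (C / c * A + s / 4) ^ 2 := by
        have h5 : d (k + 1) ^ 2 ≤ C / c * A * s := by
          rw [show C / c * A * s = A * (C * s) / c by ring, le_div_iff₀ hc]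
          linarith
        nlinarith [sq_nonneg (C / c * A - s / 4)]
      exact abs_le_of_sq_le_sq' h4 (by positivity) |>.2
  have hsum : ∀ N, ∑ k ∈ Finset.range N, d (k + 1) ≤
      C / c * (φ (r 1) - φ (r (N + 1))) + (∑ k ∈ Finset.range N, d k + (r 0 - r N)) / 4 := by
    intro N
    induction N with
    | zero => simp
    | succ N ih =>
      rw [Finset.sum_range_succ, Finset.sum_range_succ]
      have := step N
      rw [show N + 1 + 1 = N + 2 from rfl]
      linarith
  rw [← summable_nat_add_iff 1]
  -- The φ-differences telescope. With T = ∑ d (k + 1), the estimate reads T ≤ (C/c) φ(r 1) + (d 0 +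
  -- T + r 0)/4, and 4/3 ≤ 2.
  refine summable_of_sum_range_le (c := 2 * (C / c * φ (r 1) + (d 0 + r 0) / 4))
    (fun k => hd (k + 1)) fun N => ?_
  have h1 := hsum N
  have h2 : ∑ k ∈ Finset.range N, d k ≤ d 0 + ∑ k ∈ Finset.range N, d (k + 1) := by
    have h3 := Finset.sum_range_succ' d N
    have h4 := Finset.sum_range_succ d N
    linarith [hd N]
  have h3 : 0 ≤ C / c * φ (r (N + 1)) := mul_nonneg (by positivity) (hφ _ (hr _) (hr₀ _))
  have h4 : 0 ≤ C / c * φ (r 1) := mul_nonneg (by positivity) (hφ _ (hr _) (hr₀ _))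
  have h5 : 0 ≤ ∑ k ∈ Finset.range N, d (k + 1) := Finset.sum_nonneg fun k _ => hd _
  have h6 := hr N
  rw [mul_sub] at h1
  linarith [hd 0, hr 0]

variable {W : Type*} [NormedAddCommGroup W] [InnerProductSpace ℝ W] {Ψ : W → EReal}

/-- Keeps from concavity only the tangent inequality between `φ` and its slope `D`, a form stable
under addition. -/
theorem KLAt.exists_tangent {a : W} {ρ : ℝ} (h : KLAt Ψ a) (ha : Ψ a = ρ) :
    ∃ U ∈ 𝓝 a, ∃ (r₀ : ℝ) (φ D : ℝ → ℝ), 0 < r₀ ∧ (∀ t, 0 ≤ t → t < r₀ → 0 ≤ φ t) ∧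
      (∀ t, 0 < t → t < r₀ → 0 < D t) ∧
      (∀ s t, 0 ≤ s → s ≤ t → 0 < t → t < r₀ → φ s + D t * (t - s) ≤ φ t) ∧
      ∀ w ∈ U, ∀ v ∈ limitingSubdiff Ψ w, ∀ r : ℝ, Ψ w = r → ρ < r → r < ρ + r₀ →
        1 ≤ D (r - ρ) * ‖v‖ := by
  obtain ⟨R, U, φ, hR, hU, -, hconc, hφ, -, -, hD, hKL⟩ := h
  obtain ⟨q, hq0, hqR⟩ := EReal.lt_iff_exists_real_btwn.1 hR
  have hq : (0 : ℝ) < q := by exact_mod_cast hq0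
  have hlt : ∀ t : ℝ, t < q → (t : EReal) < R := fun t ht =>
    (EReal.coe_lt_coe_iff.2 ht).trans hqR
  refine ⟨U, hU, q, φ, deriv φ, hq, fun t h0 h1 => hφ t h0 (hlt t h1),
    fun t h0 h1 => hD t h0 (hlt t h1), ?_, ?_⟩
  · intro s t hs hst ht htq
    rcases hst.eq_or_lt with rfl | hst
    · simp
    · have hne : deriv φ t ≠ 0 := (hD t ht (hlt t htq)).ne'
      have h1 := hconc.deriv_le_slope ⟨hs, hlt s (hst.trans htq)⟩ ⟨ht.le, hlt t htq⟩ hst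
        (differentiableAt_of_deriv_ne_zero hne)
      rw [slope_def_field, le_div_iff₀ (by linarith)] at h1
      linarith
  · intro w hw v hv r hr hρr hrq
    have h1 := hKL w hw (by rw [ha, hr]; exact_mod_cast hρr) (by
      rw [ha, hr]
      calc (r : EReal) < ((ρ + q : ℝ) : EReal) := by exact_mod_cast hrq
        _ = (ρ : EReal) + q := EReal.coe_add _ _
        _ ≤ ρ + R := by gcongr)
    rw [ha, hr, ← EReal.coe_sub, EReal.toReal_coe] at h1
    have hpos := hD (r - ρ) (by linarith) (hlt _ (by linarith))
    have h2 : Metric.infEDist 0 (limitingSubdiff Ψ w) ≤ ENNReal.ofReal ‖v‖ := by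
      refine (Metric.infEDist_le_edist_of_mem hv).trans ?_
      rw [edist_dist, dist_zero_left]
    have h3 : (1 : ENNReal) ≤ ENNReal.ofReal (deriv φ (r - ρ) * ‖v‖) := by
      rw [ENNReal.ofReal_mul hpos.le]
      exact h1.trans (by gcongr)
    rwa [ENNReal.one_le_ofReal] at h3

/-- Finite length of a sequence with sufficient decrease and relative error for a function with
the KL property, staying in a compact set. -/
theorem HasKL.summable (hΨ : HasKL Ψ) {w v : ℕ → W} {r d : ℕ → ℝ} {ρ c C : ℝ} {Q : Set W}
    (hQ : IsCompact Q) (hw : ∀ k, w k ∈ Q) (hr : ∀ k, Ψ (w k) = r k)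
    (hlim : Tendsto r atTop (𝓝 ρ)) (hc : 0 < c) (hC : 0 ≤ C) (hd : ∀ k, 0 ≤ d k)
    (hdec : ∀ k, r (k + 1) + c * d k ^ 2 ≤ r k)
    (hv : ∀ k, v k ∈ frechetSubdiff Ψ (w k))
    (hvn : ∀ k, ‖v (k + 1)‖ ≤ C * (d k + (r k - r (k + 1))))
    (hcl : ∀ (ψ : ℕ → ℕ) (a : W), StrictMono ψ → Tendsto (w ∘ ψ) atTop (𝓝 a) → Ψ a = ρ) :
    Summable d := by
  have hanti : Antitone r := antitone_nat_of_succ_le fun k => by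
    have := hdec k
    nlinarith [mul_nonneg hc.le (sq_nonneg (d k))]
  have hρ : ∀ k, ρ ≤ r k := hanti.le_of_tendsto hlim
  have hd0 : Tendsto d atTop (𝓝 0) := by
    have h1 : Tendsto (fun k => (r k - r (k + 1)) / c) atTop (𝓝 0) := by
      have := (hlim.sub ((tendsto_add_atTop_iff_nat 1).2 hlim)).div_const c
      simpa using this
    have h2 : Tendsto (fun k => d k ^ 2) atTop (𝓝 0) :=
      squeeze_zero (fun k => sq_nonneg _) (fun k => by
        rw [le_div_iff₀ hc]; linarith [hdec k]) h1
    have h3 := h2.sqrt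
    simpa [Real.sqrt_sq, hd] using h3
  have hv0 : Tendsto v atTop (𝓝 0) := by
    rw [← tendsto_add_atTop_iff_nat 1]
    refine squeeze_zero_norm hvn ?_
    have := (hd0.add (hlim.sub ((tendsto_add_atTop_iff_nat 1).2 hlim))).const_mul C
    simpa using this
  -- One pair (φ, D) is made to serve all late iterates by induction over the compact set `Q`.
  have hp : ∃ (r₀ : ℝ) (φ D : ℝ → ℝ), 0 < r₀ ∧ (∀ t, 0 ≤ t → t < r₀ → 0 ≤ φ t) ∧
      (∀ t, 0 < t → t < r₀ → 0 < D t) ∧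
      (∀ s t, 0 ≤ s → s ≤ t → 0 < t → t < r₀ → φ s + D t * (t - s) ≤ φ t) ∧
      ∀ᶠ k in atTop, w k ∈ Q → ρ < r k → r k < ρ + r₀ → 1 ≤ D (r k - ρ) * ‖v k‖ := by
    refine hQ.induction_on (p := fun Q => ∃ (r₀ : ℝ) (φ D : ℝ → ℝ), 0 < r₀ ∧
      (∀ t, 0 ≤ t → t < r₀ → 0 ≤ φ t) ∧ (∀ t, 0 < t → t < r₀ → 0 < D t) ∧
      (∀ s t, 0 ≤ s → s ≤ t → 0 < t → t < r₀ → φ s + D t * (t - s) ≤ φ t) ∧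
      ∀ᶠ k in atTop, w k ∈ Q → ρ < r k → r k < ρ + r₀ → 1 ≤ D (r k - ρ) * ‖v k‖) ?_ ?_ ?_ ?_
    · exact ⟨1, id, fun _ => 1, one_pos, fun t h _ => h, fun _ _ _ => one_pos,
        fun s t _ _ _ _ => by simp, Eventually.of_forall fun k hk => absurd hk (by simp)⟩
    · rintro s t hst ⟨r₀, φ, D, h1, h2, h3, h4, h5⟩
      exact ⟨r₀, φ, D, h1, h2, h3, h4, h5.mono fun k hk hks => hk (hst hks)⟩
    · rintro s t ⟨r₁, φ₁, D₁, h1, h2, h3, h4, h5⟩ ⟨r₂, φ₂, D₂, g1, g2, g3, g4, g5⟩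
      -- For a union the desingularizing functions are added: since both slopes are positive, the
      -- sum satisfies the KL bound wherever one of them does.
      refine ⟨min r₁ r₂, fun x => φ₁ x + φ₂ x, fun x => D₁ x + D₂ x, lt_min h1 g1,
        fun x h0 hx => ?_, fun x h0 hx => ?_, fun a b ha hab hb hbr => ?_, ?_⟩
      · exact add_nonneg (h2 x h0 (hx.trans_le (min_le_left _ _)))
          (g2 x h0 (hx.trans_le (min_le_right _ _)))
      · exact add_pos (h3 x h0 (hx.trans_le (min_le_left _ _)))
          (g3 x h0 (hx.trans_le (min_le_right _ _)))
      · have e1 := h4 a b ha hab hb (hbr.trans_le (min_le_left _ _))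
        have e2 := g4 a b ha hab hb (hbr.trans_le (min_le_right _ _))
        simp only
        linarith
      · filter_upwards [h5, g5] with k hk gk hmem hρk hrk
        have b1 : r k < ρ + r₁ := by linarith [min_le_left r₁ r₂]
        have b2 : r k < ρ + r₂ := by linarith [min_le_right r₁ r₂]
        have p1 := h3 (r k - ρ) (by linarith) (by linarith)
        have p2 := g3 (r k - ρ) (by linarith) (by linarith)
        simp only [add_mul]
        rcases hmem with hm | hm
        · have := hk hm hρk b1
          have : 0 ≤ D₂ (r k - ρ) * ‖v k‖ := by positivity
          linarith
        · have := gk hm hρk b2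
          have : 0 ≤ D₁ (r k - ρ) * ‖v k‖ := by positivity
          linarith
    · intro a _
      -- At a cluster point Ψ equals ρ and 0 is a limiting subgradient because v → 0, so the KL
      -- property is available. Any other point has a neighbourhood that the sequence eventually
      -- avoids.
      by_cases hcp : MapClusterPt a atTop w
      · obtain ⟨ψ, hψ, hψa⟩ := hcp.tendsto_subseq
        have ha : Ψ a = ρ := hcl ψ a hψ hψa
        have h0 : (0 : W) ∈ limitingSubdiff Ψ a := by
          refine ⟨by simp [ha], by simp [ha], w ∘ ψ, v ∘ ψ, hψa, ?_, fun k => hv _,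
            hv0.comp hψ.tendsto_atTop⟩
          rw [ha]
          simp only [Function.comp_apply, hr]
          exact (continuous_coe_real_ereal.tendsto ρ).comp (hlim.comp hψ.tendsto_atTop)
        obtain ⟨U, hU, r₀, φ, D, h1, h2, h3, h4, h5⟩ := (hΨ a ⟨0, h0⟩).exists_tangent ha
        exact ⟨U, mem_nhdsWithin_of_mem_nhds hU, r₀, φ, D, h1, h2, h3, h4,
          Eventually.of_forall fun k hk hρk hrk =>
            h5 (w k) hk (v k) (frechetSubdiff_subset_limitingSubdiff _ _ (hv k)) _ (hr k)
              hρk hrk⟩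
      · rw [mapClusterPt_iff_frequently] at hcp
        push Not at hcp
        obtain ⟨s, hs, hev⟩ := hcp
        exact ⟨s, mem_nhdsWithin_of_mem_nhds hs, 1, id, fun _ => 1, one_pos, fun t h _ => h,
          fun _ _ _ => one_pos, fun s t _ _ _ _ => by simp,
          hev.mono fun k hk hks => absurd hks hk⟩
  obtain ⟨r₀, φ, D, h1, h2, h3, h4, h5⟩ := hp
  obtain ⟨N, hN⟩ := eventually_atTop.1
    (h5.and (hlim.eventually (gt_mem_nhds (by linarith : ρ < ρ + r₀))))
  rw [← summable_nat_add_iff N]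
  refine summable_of_desingularizing (r := fun k => r (k + N) - ρ) hc hC (fun k => hd _)
    (fun k => sub_nonneg.2 (hρ _)) (fun k => by linarith [(hN (k + N) (by omega)).2])
    (fun k => ?_) h2 h3 h4 (fun k hk => ?_)
  · have := hdec (k + N)
    rw [show k + 1 + N = k + N + 1 by omega]
    linarith
  · rw [show k + 1 + N = k + N + 1 by omega] at hk ⊢
    obtain ⟨e1, e2⟩ := hN (k + N + 1) (by omega)
    have e3 := e1 (hw _) (by linarith) e2
    refine e3.trans ?_
    rw [sub_sub_sub_cancel_right]
    exact mul_le_mul_of_nonneg_left (hvn _) (h3 _ hk (by linarith)).le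

end KL

/-! ### Fréchet subgradients of a quotient -/

section Quotient

variable {W : Type*} [NormedAddCommGroup W] [InnerProductSpace ℝ W]

/-- Fréchet subgradients of a quotient `N / G`, with value `+∞` off the set `P`, at a point where
`N ≥ 0`, `G > 0` and `G` is continuous relative to `P`. -/
theorem mem_frechetSubdiff_div {Ψ : W → EReal} {P : Set W} {N G : W → ℝ} {w₀ a b : W}
    (hP : w₀ ∈ P) (htop : ∀ w ∉ P, Ψ w = ⊤) (hΨ : ∀ w ∈ P, Ψ w = ((N w / G w : ℝ) : EReal))
    (hGpos : ∀ w ∈ P, 0 < G w) (hN0 : 0 ≤ N w₀)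
    (hN : ∀ ε : ℝ, 0 < ε → ∀ᶠ w in 𝓝 w₀, w ∈ P →
      N w₀ + inner ℝ a (w - w₀) - ε * ‖w - w₀‖ ≤ N w)
    (hG : ∀ ε : ℝ, 0 < ε → ∀ᶠ w in 𝓝 w₀, w ∈ P →
      G w ≤ G w₀ + inner ℝ b (w - w₀) + ε * ‖w - w₀‖)
    (hGc : Tendsto G (𝓝[P] w₀) (𝓝 (G w₀))) :
    (1 / G w₀) • (a - (N w₀ / G w₀) • b) ∈ frechetSubdiff Ψ w₀ := by
  have hG0 := hGpos w₀ hP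
  refine ⟨by rw [hΨ w₀ hP]; exact EReal.coe_ne_top _, by rw [hΨ w₀ hP]; exact EReal.coe_ne_bot _,
    fun ε hε => ?_⟩
  set q := a - (N w₀ / G w₀) • b with hq
  -- Chosen so that the errors of numerator and denominator add up to ε G(w₀)/4. With G w > G(w₀)/2
  -- they cost ε/2 after division; replacing 1/G w by 1/G(w₀) costs the other half.
  set η := ε * G w₀ / (4 * (1 + N w₀ / G w₀)) with hη
  have hden : 0 < 1 + N w₀ / G w₀ := by positivity
  have hηpos : 0 < η := by positivity
  have hinv : Tendsto (fun w => 1 / G w) (𝓝[P] w₀) (𝓝 (1 / G w₀)) :=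
    tendsto_const_nhds.div hGc hG0.ne'
  have hev1 : ∀ᶠ w in 𝓝[P] w₀, |1 / G w - 1 / G w₀| < ε / (2 * (‖q‖ + 1)) := by
    have := (Metric.tendsto_nhds.1 hinv) (ε / (2 * (‖q‖ + 1))) (by positivity)
    simpa only [Real.dist_eq] using this
  have hev2 : ∀ᶠ w in 𝓝[P] w₀, G w₀ / 2 < G w := hGc.eventually (lt_mem_nhds (by linarith))
  filter_upwards [hN η hηpos, hG η hηpos, eventually_nhdsWithin_iff.1 hev1,
    eventually_nhdsWithin_iff.1 hev2] with w h1 h2 h3 h4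
  by_cases hw : w ∈ P
  · rw [hΨ w hw, hΨ w₀ hP, ← EReal.coe_add, EReal.coe_le_coe_iff]
    specialize h1 hw
    specialize h2 hw
    specialize h3 hw
    specialize h4 hw
    have hGw := hGpos w hw
    set n := ‖w - w₀‖ with hn
    have hn0 : 0 ≤ n := norm_nonneg _
    have hiq : inner ℝ q (w - w₀) = inner ℝ a (w - w₀) - N w₀ / G w₀ * inner ℝ b (w - w₀) := by
      rw [hq, inner_sub_left, inner_smul_left]
      simp
    have hR : 0 ≤ N w₀ / G w₀ := by positivity
    -- Since N(w₀)/G(w₀) ≥ 0, an upper estimate of `G` suffices for a lower estimate of the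
    -- quotient.
    have e1 : N w / G w - N w₀ / G w₀
        = 1 / G w * ((N w - N w₀) - N w₀ / G w₀ * (G w - G w₀)) := by
      field_simp
      ring
    have e2 : inner ℝ q (w - w₀) - (1 + N w₀ / G w₀) * η * n
        ≤ (N w - N w₀) - N w₀ / G w₀ * (G w - G w₀) := by
      have := mul_le_mul_of_nonneg_left h2 hR
      rw [hiq]
      nlinarith
    have e3 : (1 + N w₀ / G w₀) * η = ε * G w₀ / 4 := by
      rw [hη]
      field_simp
    have e4 : 1 / G w * (inner ℝ q (w - w₀) - ε * G w₀ / 4 * n)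
        ≤ N w / G w - N w₀ / G w₀ := by
      rw [e1, ← e3]
      exact mul_le_mul_of_nonneg_left e2 (by positivity)
    have e5 : 1 / G w * (ε * G w₀ / 4 * n) ≤ ε / 2 * n := by
      have : 1 / G w * (ε * G w₀ / 4) ≤ ε / 2 := by
        rw [div_mul_eq_mul_div, one_mul, div_le_iff₀ hGw]
        nlinarith
      nlinarith
    have e6 : |(1 / G w - 1 / G w₀) * inner ℝ q (w - w₀)| ≤ ε / 2 * n := by
      rw [abs_mul]
      calc _ ≤ ε / (2 * (‖q‖ + 1)) * (‖q‖ * n) := by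
            gcongr
            exact abs_real_inner_le_norm _ _
        _ = ε / 2 * n * (‖q‖ / (‖q‖ + 1)) := by field_simp
        _ ≤ ε / 2 * n * 1 := by
            gcongr
            rw [div_le_one (by positivity)]
            linarith
        _ = ε / 2 * n := mul_one _
    have e7 := (abs_le.1 e6).1
    rw [inner_smul_left]
    simp only [RCLike.conj_to_real]
    nlinarith
  · rw [htop w hw]
    exact le_top

end Quotient

/-! ### Consequences of the standing assumptions -/

section Data

variable {n p : ℕ} {S : Set (E n)} {g : E n → EReal} {h : E n → ℝ} {L : NNReal}
  {f : E p → EReal} {K : E n →L[ℝ] E p} {δ σ : ℝ}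

/-- The real value `g x + h x + ‖x - u‖² / (2δ)` of `φ` on `(S ∩ dom g) × ℝⁿ`. -/
noncomputable def phiReal (g : E n → EReal) (h : E n → ℝ) (δ : ℝ) (x u : E n) : ℝ :=
  (g x).toReal + h x + 1 / (2 * δ) * ‖x - u‖ ^ 2

theorem StandingAssumptions.phi_eq (hA : StandingAssumptions S g h L f K) {x : E n} (hx : x ∈ S)
    (hgx : g x ≠ ⊤) (u : E n) : phi S g h δ x u = (phiReal g h δ x u : ℝ) := by
  rw [phi, phiReal, ← hA.proper_g.coe_toReal hgx]
  simp [indicatorFun, hx]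

theorem StandingAssumptions.phi_eq_top (hA : StandingAssumptions S g h L f K) {x : E n}
    (hx : ¬(x ∈ S ∧ g x ≠ ⊤)) (u : E n) : phi S g h δ x u = ⊤ := by
  rw [phi]
  have hb : g x ≠ ⊥ := hA.proper_g.1 x
  by_cases hS : x ∈ S
  · have hg : g x = ⊤ := by
      by_contra hne
      exact hx ⟨hS, hne⟩
    rw [hg, EReal.top_add_coe]
    simp only [indicatorFun, hS, if_true, add_zero]
    exact EReal.top_add_coe _
  · have h1 : g x + (h x : EReal) ≠ ⊥ := by simp [EReal.add_eq_bot_iff, hb]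
    rw [indicatorFun, if_neg hS, EReal.add_top_of_ne_bot h1, EReal.top_add_coe]

theorem StandingAssumptions.f_ne_top (hA : StandingAssumptions S g h L f K) {x : E n}
    (hx : x ∈ S) : f (K x) ≠ ⊤ :=
  have h1 : K x ∈ edom f := interior_subset (hA.image_subset ⟨x, hx, rfl⟩)
  ne_of_lt h1

theorem StandingAssumptions.coe_f (hA : StandingAssumptions S g h L f K) {x : E n}
    (hx : x ∈ S) : ((f (K x)).toReal : EReal) = f (K x) :=
  hA.proper_f.coe_toReal (hA.f_ne_top hx)

theorem StandingAssumptions.toReal_f_pos (hA : StandingAssumptions S g h L f K) {x : E n}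
    (hx : x ∈ S) : 0 < (f (K x)).toReal := by
  have h1 := hA.pos_f x hx
  rw [← hA.coe_f hx] at h1
  exact_mod_cast h1

theorem StandingAssumptions.add_nonneg (hA : StandingAssumptions S g h L f K) {x : E n}
    (hx : x ∈ S) (hgx : g x ≠ ⊤) : 0 ≤ (g x).toReal + h x := by
  have h1 : (0 : EReal) ≤ g x + (h x : EReal) := hA.inf_nonneg.trans (iInf₂_le x hx)
  rw [← hA.proper_g.coe_toReal hgx] at h1
  exact_mod_cast h1

theorem StandingAssumptions.phiReal_nonneg (hA : StandingAssumptions S g h L f K) (hδ : 0 < δ)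
    {x : E n} (hx : x ∈ S) (hgx : g x ≠ ⊤) (u : E n) : 0 ≤ phiReal g h δ x u := by
  have := hA.add_nonneg hx hgx
  rw [phiReal]
  positivity

theorem StandingAssumptions.hasGradientAt (hA : StandingAssumptions S g h L f K) {a : E n}
    (ha : a ∈ S) : HasGradientAt h (gradient h a) a := by
  obtain ⟨O, hO, hSO, hd, -⟩ := hA.smooth_h
  exact (hd.differentiableAt (hO.mem_nhds (hSO ha))).hasGradientAt

theorem StandingAssumptions.norm_gradient_sub_le (hA : StandingAssumptions S g h L f K)
    {a b : E n} (ha : a ∈ S) (hb : b ∈ S) :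
    ‖gradient h a - gradient h b‖ ≤ L * ‖a - b‖ := by
  obtain ⟨O, hO, hSO, -, hl⟩ := hA.smooth_h
  exact hl.norm_sub_le (hSO ha) (hSO hb)

theorem StandingAssumptions.continuousOn_gradient (hA : StandingAssumptions S g h L f K) :
    ContinuousOn (gradient h) S := by
  obtain ⟨O, hO, hSO, -, hl⟩ := hA.smooth_h
  exact hl.continuousOn.mono hSO

/-- The descent lemma on the convex set `S`. -/
theorem StandingAssumptions.h_le (hA : StandingAssumptions S g h L f K) {a b : E n}
    (ha : a ∈ S) (hb : b ∈ S) :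
    h b ≤ h a + inner ℝ (gradient h a) (b - a) + L / 2 * ‖b - a‖ ^ 2 := by
  have hmem : ∀ t ∈ Set.Icc (0 : ℝ) 1, a + t • (b - a) ∈ S := by
    intro t ht
    have := hA.convex_S ha hb (by linarith [ht.2] : (0 : ℝ) ≤ 1 - t) ht.1 (by ring)
    rwa [show (1 - t) • a + t • b = a + t • (b - a) by module] at this
  -- The Taylor remainder along the segment minus its quadratic bound; its derivative is nonpositive
  -- by Cauchy–Schwarz and the Lipschitz bound.
  let ψ : ℝ → ℝ := fun t =>
    h (a + t • (b - a)) - t * inner ℝ (gradient h a) (b - a) - L / 2 * ‖b - a‖ ^ 2 * t ^ 2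
  have hder : ∀ t ∈ Set.Icc (0 : ℝ) 1, HasDerivAt ψ
      (inner ℝ (gradient h (a + t • (b - a))) (b - a) - inner ℝ (gradient h a) (b - a)
        - L / 2 * ‖b - a‖ ^ 2 * (2 * t)) t := by
    intro t ht
    have h1 : HasDerivAt (fun t : ℝ => a + t • (b - a)) (b - a) t := by
      simpa using ((hasDerivAt_id t).smul_const (b - a)).const_add a
    have h2 := (hA.hasGradientAt (hmem t ht)).hasFDerivAt.comp_hasDerivAt t h1
    have h3 := (hasDerivAt_id t).mul_const (inner ℝ (gradient h a) (b - a))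
    have h4 : HasDerivAt (fun t : ℝ => L / 2 * ‖b - a‖ ^ 2 * t ^ 2)
        (L / 2 * ‖b - a‖ ^ 2 * (2 * t)) t := by
      simpa using (hasDerivAt_pow 2 t).const_mul ((L : ℝ) / 2 * ‖b - a‖ ^ 2)
    refine HasDerivAt.congr_deriv (f := ψ) ((h2.sub h3).sub h4) ?_
    simp
  have hanti : AntitoneOn ψ (Set.Icc 0 1) := by
    refine antitoneOn_of_deriv_nonpos (convex_Icc 0 1)
      (fun t ht => (hder t ht).continuousAt.continuousWithinAt)
      (fun t ht => (hder t (interior_subset ht)).differentiableAt.differentiableWithinAt)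
      fun t ht => ?_
    have ht' := interior_subset ht
    rw [(hder t ht').deriv, ← inner_sub_left]
    have h1 := real_inner_le_norm (gradient h (a + t • (b - a)) - gradient h a) (b - a)
    have h2 := hA.norm_gradient_sub_le (hmem t ht') ha
    rw [add_sub_cancel_left, norm_smul, Real.norm_of_nonneg ht'.1] at h2
    have h3 := mul_le_mul_of_nonneg_right h2 (norm_nonneg (b - a))
    nlinarith
  have := hanti (Set.left_mem_Icc.2 zero_le_one) (Set.right_mem_Icc.2 zero_le_one) zero_le_one
  simp only [ψ, one_smul, zero_smul, add_sub_cancel, add_zero] at this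
  linarith

theorem StandingAssumptions.continuousAt_f (hA : StandingAssumptions S g h L f K) {a : E n}
    (ha : a ∈ S) : ContinuousAt (fun z => (f z).toReal) (K a) :=
  (hA.convex_f.convexOn_toReal hA.proper_f).continuousOn_interior.continuousAt
    (isOpen_interior.mem_nhds (hA.image_subset ⟨a, ha, rfl⟩))

theorem StandingAssumptions.exists_f_le (hA : StandingAssumptions S g h L f K) :
    ∃ M : ℝ, 0 < M ∧ ∀ a ∈ S, (f (K a)).toReal ≤ M := by
  have hc : ContinuousOn (fun a => (f (K a)).toReal) S := fun a ha =>
    ((hA.continuousAt_f ha).comp (f := K) K.continuous.continuousAt).continuousWithinAt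
  obtain ⟨M, hM⟩ := hA.compact_S.bddAbove_image hc
  exact ⟨max M 1, by positivity, fun a ha => (hM ⟨a, ha, rfl⟩).trans (le_max_left _ _)⟩

/-- Subgradients of `f` on `K(S)` are bounded. -/
theorem StandingAssumptions.exists_subgradient_norm_le (hA : StandingAssumptions S g h L f K) :
    ∃ B : ℝ, 0 ≤ B ∧ ∀ a ∈ S, ∀ v ∈ limitingSubdiff f (K a), ‖v‖ ≤ B := by
  have hcomp : IsCompact (K '' S) := hA.compact_S.image K.continuous
  obtain ⟨r, hr, hsub⟩ := hcomp.exists_cthickening_subset_open isOpen_interior hA.image_subset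
  have hc : ContinuousOn (fun z => (f z).toReal) (Metric.cthickening r (K '' S)) :=
    (hA.convex_f.convexOn_toReal hA.proper_f).continuousOn_interior.mono hsub
  obtain ⟨M, hM⟩ := hcomp.cthickening.bddAbove_image hc
  refine ⟨max 0 (M / r), le_max_left _ _, fun a ha v hv => ?_⟩
  by_cases hv0 : v = 0
  · simp [hv0]
  · have hvn : 0 < ‖v‖ := norm_pos_iff.2 hv0
    -- Moving a distance `r` in the direction of `v` stays in the compact thickening where `f` ≤ M,
    -- and the subgradient inequality gives r ‖v‖ ≤ M - f(K a).
    set z := K a + (r / ‖v‖) • v with hz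
    have hzm : z ∈ Metric.cthickening r (K '' S) := by
      refine Metric.mem_cthickening_of_dist_le z (K a) r _ ⟨a, ha, rfl⟩ ?_
      rw [hz, dist_eq_norm, add_sub_cancel_left, norm_smul, Real.norm_of_nonneg (by positivity),
        div_mul_cancel₀ _ hvn.ne']
    have h1 := hA.convex_f.le_of_mem_limitingSubdiff hA.proper_f hv
      (interior_subset (hsub hzm) : z ∈ edom f)
    have h2 : (f z).toReal ≤ M := hM ⟨z, hzm, rfl⟩
    rw [hz, add_sub_cancel_left, inner_smul_right, real_inner_self_eq_norm_sq, ← hz] at h1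
    have h3 : r / ‖v‖ * ‖v‖ ^ 2 = r * ‖v‖ := by field_simp
    have h4 := hA.toReal_f_pos ha
    refine le_trans ?_ (le_max_right _ _)
    rw [le_div_iff₀ hr]
    linarith

end Data

/-! ### Descent, limits of the iterates and stationarity -/

section Iteration

variable {n p : ℕ} {S : Set (E n)} {g : E n → EReal} {h : E n → ℝ} {L : NNReal}
  {f : E p → EReal} {K : E n →L[ℝ] E p} {δ σ : ℝ}
  {x : ℕ → E n} {y : ℕ → E p} {u : ℕ → E n} {θ : ℕ → ℝ}

theorem IsFPSA.mem (hi : IsFPSA S g h f K δ σ x y u θ) : ∀ k, x k ∈ S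
  | 0 => hi.start.1
  | k + 1 => hi.x_mem k

/-- Finiteness comes from θ being real-valued: ϑ would be +∞ outside dom g. -/
theorem IsFPSA.g_ne_top (hi : IsFPSA S g h f K δ σ x y u θ)
    (hA : StandingAssumptions S g h L f K) (k : ℕ) : g (x k) ≠ ⊤ := by
  intro hg
  have h1 := hi.theta_eq k
  rw [vartheta, if_pos (hA.phi_eq_top (fun hx => hx.2 hg) _)] at h1
  exact EReal.coe_ne_top _ h1

theorem IsFPSA.theta_eq_div (hi : IsFPSA S g h f K δ σ x y u θ)
    (hA : StandingAssumptions S g h L f K) (k : ℕ) :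
    θ k = phiReal g h δ (x k) (u k) / (f (K (x k))).toReal := by
  have h1 := hi.theta_eq k
  rw [vartheta, hA.phi_eq (hi.mem k) (hi.g_ne_top hA k), if_neg (EReal.coe_ne_top _),
    ← hA.coe_f (hi.mem k), ← EReal.coe_div] at h1
  exact_mod_cast h1

theorem IsFPSA.theta_mul (hi : IsFPSA S g h f K δ σ x y u θ)
    (hA : StandingAssumptions S g h L f K) (k : ℕ) :
    θ k * (f (K (x k))).toReal = phiReal g h δ (x k) (u k) := by
  rw [hi.theta_eq_div hA, div_mul_cancel₀ _ (hA.toReal_f_pos (hi.mem k)).ne']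

theorem IsFPSA.theta_nonneg (hi : IsFPSA S g h f K δ σ x y u θ)
    (hA : StandingAssumptions S g h L f K) (hδ : 0 < δ) (k : ℕ) : 0 ≤ θ k := by
  rw [hi.theta_eq_div hA]
  exact div_nonneg (hA.phiReal_nonneg hδ (hi.mem k) (hi.g_ne_top hA k) _)
    (hA.toReal_f_pos (hi.mem k)).le

theorem IsFPSA.f_subgradient (hi : IsFPSA S g h f K δ σ x y u θ)
    (hA : StandingAssumptions S g h L f K) (k : ℕ) {z : E p} (hz : z ∈ edom f) :
    (f (K (x k))).toReal + inner ℝ (y (k + 1)) (z - K (x k)) ≤ (f z).toReal :=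
  hA.convex_f.le_of_mem_limitingSubdiff hA.proper_f (hi.y_step k) hz

/-- The subgradient of `g + ι_S` at `x (k + 1)` given by the proximal step. -/
noncomputable def proxSubgradient (h : E n → ℝ) (K : E n →L[ℝ] E p) (δ : ℝ) (x : ℕ → E n)
    (y : ℕ → E p) (u : ℕ → E n) (θ : ℕ → ℝ) (k : ℕ) : E n :=
  (1 / δ) • (u k - x (k + 1)) - gradient h (x k)
    + θ k • (ContinuousLinearMap.adjoint K) (y (k + 1))

/-- Being tested only against points of `S`, this is a subgradient inequality for g + ι_S and
requires no qualification condition. -/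
theorem IsFPSA.g_subgradient (hi : IsFPSA S g h f K δ σ x y u θ)
    (hA : StandingAssumptions S g h L f K) (hδ : 0 < δ) (k : ℕ) {z : E n} (hz : z ∈ S)
    (hgz : g z ≠ ⊤) :
    (g (x (k + 1))).toReal + inner ℝ (proxSubgradient h K δ x y u θ k) (z - x (k + 1))
      ≤ (g z).toReal := by
  set q := u k - δ • gradient h (x k)
    + (θ k * δ) • (ContinuousLinearMap.adjoint K) (y (k + 1)) with hq
  have hmin : IsMinOn (fun z => g z + ((1 / (2 * δ) * ‖z - q‖ ^ 2 : ℝ) : EReal)) S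
      (x (k + 1)) := by
    have h0 : ∀ z, z - q = z - u k + δ • gradient h (x k)
        - (θ k * δ) • (ContinuousLinearMap.adjoint K) (y (k + 1)) := fun z => by
      rw [hq]; abel
    simpa only [h0] using hi.x_step k
  have h1 := hA.convex_g.le_of_isMinOn_prox hA.proper_g hA.convex_S hδ (hi.x_mem k)
    (hi.g_ne_top hA (k + 1)) hmin hz hgz
  have h2 : (1 / δ) • (q - x (k + 1)) = proxSubgradient h K δ x y u θ k := by
    rw [hq, proxSubgradient]
    have : (1 / δ) * δ = 1 := by field_simp
    rw [show u k - δ • gradient h (x k) + (θ k * δ) • (ContinuousLinearMap.adjoint K) (y (k + 1))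
      - x (k + 1) = (u k - x (k + 1)) - δ • gradient h (x k)
        + (θ k * δ) • (ContinuousLinearMap.adjoint K) (y (k + 1)) by abel,
      smul_add, smul_sub, smul_smul, smul_smul, this,
      show 1 / δ * (θ k * δ) = θ k by field_simp, one_smul]
  rwa [h2] at h1

theorem IsFPSA.sub_u_eq (hi : IsFPSA S g h f K δ σ x y u θ) (k : ℕ) :
    u (k + 1) - u k = σ • (x (k + 1) - u k) := by
  rw [hi.u_step]
  module

theorem IsFPSA.x_sub_u_eq (hi : IsFPSA S g h f K δ σ x y u θ) (k : ℕ) :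
    x (k + 1) - u (k + 1) = (1 - σ) • (x (k + 1) - u k) := by
  rw [hi.u_step]
  module

/-- The proximal inequality at xₖ is added to the descent lemma for `h`, and φ(xₖ, uₖ) is rewritten
as θₖ f(K xₖ). -/
theorem IsFPSA.phiReal_descent (hi : IsFPSA S g h f K δ σ x y u θ)
    (hA : StandingAssumptions S g h L f K) (hδ : 0 < δ) (hσ : 0 < σ) (k : ℕ) :
    phiReal g h δ (x (k + 1)) (u (k + 1))
      + (2 - σ) / (2 * δ * σ) * ‖u k - u (k + 1)‖ ^ 2
      + (1 / δ - L) / 2 * ‖x k - x (k + 1)‖ ^ 2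
      ≤ θ k * ((f (K (x k))).toReal + inner ℝ (y (k + 1)) (K (x (k + 1)) - K (x k))) := by
  have h1 := hi.g_subgradient hA hδ k (hi.mem k) (hi.g_ne_top hA k)
  have h2 := hA.h_le (hi.mem k) (hi.x_mem k)
  have h3 := hi.theta_mul hA k
  have h4 : ‖u k - u (k + 1)‖ ^ 2 = σ ^ 2 * ‖x (k + 1) - u k‖ ^ 2 := by
    rw [norm_sub_rev, hi.sub_u_eq, norm_smul, mul_pow, Real.norm_eq_abs, sq_abs]
  have h5 : ‖x (k + 1) - u (k + 1)‖ ^ 2 = (1 - σ) ^ 2 * ‖x (k + 1) - u k‖ ^ 2 := by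
    rw [hi.x_sub_u_eq, norm_smul, mul_pow, Real.norm_eq_abs, sq_abs]
  set Δ := x (k + 1) - x k with hΔ
  have h6 : ‖x k - u k‖ ^ 2 = ‖x (k + 1) - u k‖ ^ 2 - 2 * inner ℝ (x (k + 1) - u k) Δ
      + ‖Δ‖ ^ 2 := by
    rw [← norm_sub_sq_real, hΔ]
    congr 2
    abel
  have h7 : inner ℝ (proxSubgradient h K δ x y u θ k) (x k - x (k + 1))
      = 1 / δ * inner ℝ (x (k + 1) - u k) Δ + inner ℝ (gradient h (x k)) Δ
        - θ k * inner ℝ (y (k + 1)) (K (x (k + 1)) - K (x k)) := by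
    rw [← neg_sub (x (k + 1)) (x k), ← hΔ, inner_neg_right, proxSubgradient, inner_add_left,
      inner_sub_left, inner_smul_left, inner_smul_left, ContinuousLinearMap.adjoint_inner_left,
      ← neg_sub (x (k + 1)) (u k), inner_neg_left, hΔ, map_sub]
    simp only [RCLike.conj_to_real]
    ring
  rw [h7] at h1
  rw [norm_sub_rev (x k), ← hΔ, h4]
  rw [phiReal] at h3
  rw [h6] at h3
  rw [phiReal, h5, mul_add, h3]
  -- The relaxation is lossless because σ(2 - σ) + (1 - σ)² = 1.
  have h8 : (2 - σ) / (2 * δ * σ) * (σ ^ 2 * ‖x (k + 1) - u k‖ ^ 2)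
      + 1 / (2 * δ) * ((1 - σ) ^ 2 * ‖x (k + 1) - u k‖ ^ 2)
      = 1 / (2 * δ) * ‖x (k + 1) - u k‖ ^ 2 := by
    have := hσ.ne'
    field_simp
    ring
  have h9 : 1 / δ = 2 * (1 / (2 * δ)) := by field_simp
  rw [h9] at h1 ⊢
  linarith

/-- The length of the `k`-th step. -/
noncomputable def stepLength (x u : ℕ → E n) (k : ℕ) : ℝ :=
  ‖x k - x (k + 1)‖ + ‖u k - u (k + 1)‖

theorem stepLength_nonneg (x u : ℕ → E n) (k : ℕ) : 0 ≤ stepLength x u k := by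
  rw [stepLength]; positivity

theorem IsFPSA.exists_descent (hi : IsFPSA S g h f K δ σ x y u θ)
    (hA : StandingAssumptions S g h L f K) (hδ : 0 < δ) (hδL : δ * (L : ℝ) < 1) (hσ : 0 < σ)
    (hσ2 : σ < 2) :
    ∃ c : ℝ, 0 < c ∧ ∀ k, phiReal g h δ (x (k + 1)) (u (k + 1)) + c * stepLength x u k ^ 2
      ≤ θ k * ((f (K (x k))).toReal + inner ℝ (y (k + 1)) (K (x (k + 1)) - K (x k))) := by
  have hα : 0 < (2 - σ) / (2 * δ * σ) := div_pos (by linarith) (by positivity)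
  have hβ : 0 < (1 / δ - L) / 2 := by
    have : (L : ℝ) < 1 / δ := by rw [lt_div_iff₀ hδ]; linarith
    linarith
  -- The extra factor 1/2 pays for (a + b)² ≤ 2a² + 2b².
  set c := min ((2 - σ) / (2 * δ * σ)) ((1 / δ - L) / 2) / 2 with hc
  refine ⟨c, half_pos (lt_min hα hβ), fun k => ?_⟩
  refine le_trans ?_ (hi.phiReal_descent hA hδ hσ k)
  have h1 : 2 * c ≤ (2 - σ) / (2 * δ * σ) := by
    rw [hc]; linarith [min_le_left ((2 - σ) / (2 * δ * σ)) ((1 / δ - L) / 2)]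
  have h2 : 2 * c ≤ (1 / δ - L) / 2 := by
    rw [hc]; linarith [min_le_right ((2 - σ) / (2 * δ * σ)) ((1 / δ - L) / 2)]
  have hc0 : 0 < c := half_pos (lt_min hα hβ)
  have h3 := mul_le_mul_of_nonneg_right h1 (sq_nonneg ‖u k - u (k + 1)‖)
  have h4 := mul_le_mul_of_nonneg_right h2 (sq_nonneg ‖x k - x (k + 1)‖)
  have h5 := mul_nonneg hc0.le (sq_nonneg (‖x k - x (k + 1)‖ - ‖u k - u (k + 1)‖))
  rw [stepLength]
  linarith

theorem IsFPSA.linearized_f_le (hi : IsFPSA S g h f K δ σ x y u θ)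
    (hA : StandingAssumptions S g h L f K) (k : ℕ) :
    (f (K (x k))).toReal + inner ℝ (y (k + 1)) (K (x (k + 1)) - K (x k))
      ≤ (f (K (x (k + 1)))).toReal :=
  hi.f_subgradient hA k (lt_top_iff_ne_top.2 (hA.f_ne_top (hi.x_mem k)))

theorem IsFPSA.exists_theta_descent (hi : IsFPSA S g h f K δ σ x y u θ)
    (hA : StandingAssumptions S g h L f K) (hδ : 0 < δ) (hδL : δ * (L : ℝ) < 1) (hσ : 0 < σ)
    (hσ2 : σ < 2) : ∃ c : ℝ, 0 < c ∧ ∀ k, θ (k + 1) + c * stepLength x u k ^ 2 ≤ θ k := by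
  obtain ⟨c, hc, hdec⟩ := hi.exists_descent hA hδ hδL hσ hσ2
  obtain ⟨M, hM, hfM⟩ := hA.exists_f_le
  refine ⟨c / M, by positivity, fun k => ?_⟩
  have h1 := hdec k
  have h2 := mul_le_mul_of_nonneg_left (hi.linearized_f_le hA k) (hi.theta_nonneg hA hδ k)
  have h3 := hA.toReal_f_pos (hi.x_mem k)
  have h4 := hfM _ (hi.x_mem k)
  rw [← hi.theta_mul hA] at h1
  have h5 : c / M * stepLength x u k ^ 2 * (f (K (x (k + 1)))).toReal
      ≤ c * stepLength x u k ^ 2 := by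
    calc _ ≤ c / M * stepLength x u k ^ 2 * M := by gcongr
      _ = _ := by field_simp
  refine le_of_mul_le_mul_right ?_ h3
  linarith

theorem IsFPSA.exists_tendsto_theta (hi : IsFPSA S g h f K δ σ x y u θ)
    (hA : StandingAssumptions S g h L f K) (hδ : 0 < δ) (hδL : δ * (L : ℝ) < 1) (hσ : 0 < σ)
    (hσ2 : σ < 2) : Antitone θ ∧ ∃ ρ, Tendsto θ atTop (𝓝 ρ) := by
  obtain ⟨c, hc, hdec⟩ := hi.exists_theta_descent hA hδ hδL hσ hσ2
  have hanti : Antitone θ := antitone_nat_of_succ_le fun k => by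
    have := hdec k
    nlinarith [mul_nonneg hc.le (sq_nonneg (stepLength x u k))]
  exact ⟨hanti, _, tendsto_atTop_ciInf hanti
    ⟨0, by rintro _ ⟨k, rfl⟩; exact hi.theta_nonneg hA hδ k⟩⟩

theorem IsFPSA.tendsto_stepLength (hi : IsFPSA S g h f K δ σ x y u θ)
    (hA : StandingAssumptions S g h L f K) (hδ : 0 < δ) (hδL : δ * (L : ℝ) < 1) (hσ : 0 < σ)
    (hσ2 : σ < 2) : Tendsto (stepLength x u) atTop (𝓝 0) := by
  obtain ⟨c, hc, hdec⟩ := hi.exists_theta_descent hA hδ hδL hσ hσ2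
  obtain ⟨-, ρ, hρ⟩ := hi.exists_tendsto_theta hA hδ hδL hσ hσ2
  have h1 : Tendsto (fun k => (θ k - θ (k + 1)) / c) atTop (𝓝 0) := by
    have := (hρ.sub ((tendsto_add_atTop_iff_nat 1).2 hρ)).div_const c
    simpa using this
  have h2 : Tendsto (fun k => stepLength x u k ^ 2) atTop (𝓝 0) :=
    squeeze_zero (fun k => sq_nonneg _) (fun k => by
      rw [le_div_iff₀ hc]; linarith [hdec k]) h1
  have h3 := h2.sqrt
  simpa [Real.sqrt_sq, stepLength_nonneg] using h3

theorem IsFPSA.norm_x_sub_u_le (hi : IsFPSA S g h f K δ σ x y u θ) (hσ : 0 < σ) (k : ℕ) :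
    ‖x (k + 1) - u k‖ ≤ 1 / σ * stepLength x u k := by
  have h1 : ‖u k - u (k + 1)‖ = σ * ‖x (k + 1) - u k‖ := by
    rw [norm_sub_rev, hi.sub_u_eq, norm_smul, Real.norm_of_nonneg hσ.le]
  rw [div_mul_eq_mul_div, one_mul, le_div_iff₀ hσ, stepLength, h1]
  linarith [norm_nonneg (x k - x (k + 1))]

theorem IsFPSA.norm_x_sub_u_succ_le (hi : IsFPSA S g h f K δ σ x y u θ) (hσ : 0 < σ)
    (hσ2 : σ < 2) (k : ℕ) : ‖x (k + 1) - u (k + 1)‖ ≤ 1 / σ * stepLength x u k := by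
  refine le_trans ?_ (hi.norm_x_sub_u_le hσ k)
  rw [hi.x_sub_u_eq, norm_smul]
  exact mul_le_of_le_one_left (norm_nonneg _) (abs_le.2 ⟨by linarith, by linarith⟩)

theorem IsFPSA.tendsto_x_sub_u (hi : IsFPSA S g h f K δ σ x y u θ)
    (hA : StandingAssumptions S g h L f K) (hδ : 0 < δ) (hδL : δ * (L : ℝ) < 1) (hσ : 0 < σ)
    (hσ2 : σ < 2) : Tendsto (fun k => x (k + 1) - u k) atTop (𝓝 0) ∧
      Tendsto (fun k => x (k + 1) - u (k + 1)) atTop (𝓝 0) := by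
  have h1 : Tendsto (fun k => 1 / σ * stepLength x u k) atTop (𝓝 0) := by
    simpa using (hi.tendsto_stepLength hA hδ hδL hσ hσ2).const_mul (1 / σ)
  exact ⟨squeeze_zero_norm (hi.norm_x_sub_u_le hσ) h1,
    squeeze_zero_norm (hi.norm_x_sub_u_succ_le hσ hσ2) h1⟩

theorem IsFPSA.tendsto_x_sub_x (hi : IsFPSA S g h f K δ σ x y u θ)
    (hA : StandingAssumptions S g h L f K) (hδ : 0 < δ) (hδL : δ * (L : ℝ) < 1) (hσ : 0 < σ)
    (hσ2 : σ < 2) : Tendsto (fun k => x (k + 1) - x k) atTop (𝓝 0) := by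
  refine squeeze_zero_norm (fun k => ?_) (hi.tendsto_stepLength hA hδ hδL hσ hσ2)
  rw [norm_sub_rev, stepLength]
  linarith [norm_nonneg (u k - u (k + 1))]

theorem IsFPSA.exists_y_bound (hi : IsFPSA S g h f K δ σ x y u θ)
    (hA : StandingAssumptions S g h L f K) : ∃ B : ℝ, 0 ≤ B ∧ ∀ k, ‖y (k + 1)‖ ≤ B := by
  obtain ⟨B, hB, hy⟩ := hA.exists_subgradient_norm_le
  exact ⟨B, hB, fun k => hy _ (hi.mem k) _ (hi.y_step k)⟩

theorem IsFPSA.exists_proxSubgradient_bound (hi : IsFPSA S g h f K δ σ x y u θ)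
    (hA : StandingAssumptions S g h L f K) (hδ : 0 < δ) (hδL : δ * (L : ℝ) < 1) (hσ : 0 < σ)
    (hσ2 : σ < 2) : ∃ B : ℝ, ∀ k, ‖proxSubgradient h K δ x y u θ k‖ ≤ B := by
  obtain ⟨By, hBy0, hBy⟩ := hi.exists_y_bound hA
  obtain ⟨Bh, hBh⟩ := hA.compact_S.exists_bound_of_continuousOn hA.continuousOn_gradient
  obtain ⟨Bx, hBx⟩ := (Metric.isBounded_range_of_tendsto _
    (hi.tendsto_x_sub_u hA hδ hδL hσ hσ2).1).exists_norm_le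
  obtain ⟨hanti, -⟩ := hi.exists_tendsto_theta hA hδ hδL hσ hσ2
  refine ⟨1 / δ * Bx + Bh + θ 0 * (‖ContinuousLinearMap.adjoint K‖ * By), fun k => ?_⟩
  have h0 := hi.theta_nonneg hA hδ k
  have h00 := hi.theta_nonneg hA hδ 0
  have h1 : ‖(1 / δ) • (u k - x (k + 1))‖ ≤ 1 / δ * Bx := by
    rw [norm_smul, Real.norm_of_nonneg (by positivity), norm_sub_rev]
    exact mul_le_mul_of_nonneg_left (hBx _ ⟨k, rfl⟩) (by positivity)
  have h2 : ‖θ k • (ContinuousLinearMap.adjoint K) (y (k + 1))‖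
      ≤ θ 0 * (‖ContinuousLinearMap.adjoint K‖ * By) := by
    rw [norm_smul, Real.norm_of_nonneg h0]
    have h3 := (ContinuousLinearMap.adjoint K).le_opNorm (y (k + 1))
    exact mul_le_mul (hanti (Nat.zero_le k)) (h3.trans (by gcongr; exact hBy k))
      (norm_nonneg _) h00
  have h3 := hBh _ (hi.mem k)
  rw [proxSubgradient]
  exact (norm_add_le _ _).trans (add_le_add ((norm_sub_le _ _).trans (add_le_add h1 h3)) h2)

/-- Along a subsequence of `x (k + 1)` converging to `a`, the values of `g` converge to `g a`. -/
theorem IsFPSA.tendsto_g (hi : IsFPSA S g h f K δ σ x y u θ)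
    (hA : StandingAssumptions S g h L f K) (hδ : 0 < δ) (hδL : δ * (L : ℝ) < 1) (hσ : 0 < σ)
    (hσ2 : σ < 2) {ψ : ℕ → ℕ} {a : E n}
    (ha : Tendsto (fun j => x (ψ j + 1)) atTop (𝓝 a)) :
    a ∈ S ∧ g a ≠ ⊤ ∧ Tendsto (fun j => (g (x (ψ j + 1))).toReal) atTop (𝓝 (g a).toReal) := by
  have haS : a ∈ S := hA.compact_S.isClosed.mem_of_tendsto ha
    (Eventually.of_forall fun j => hi.x_mem _)
  obtain ⟨B, hB⟩ := hi.exists_proxSubgradient_bound hA hδ hδL hσ hσ2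
  obtain ⟨z₀, hz₀S, hz₀⟩ := hA.feasible
  -- Bounded proximal subgradients give the upper estimate of `g` along the iterates; at z = a it
  -- complements lower semicontinuity, and at a feasible `z₀` it excludes g a = +∞.
  have hup : ∀ z ∈ S, g z ≠ ⊤ → ∀ j,
      (g (x (ψ j + 1))).toReal ≤ (g z).toReal + B * ‖z - x (ψ j + 1)‖ := by
    intro z hz hgz j
    have h1 := hi.g_subgradient hA hδ (ψ j) hz hgz
    have h2 := (abs_le.1 (abs_real_inner_le_norm (proxSubgradient h K δ x y u θ (ψ j))
      (z - x (ψ j + 1)))).1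
    have h3 := mul_le_mul_of_nonneg_right (hB (ψ j)) (norm_nonneg (z - x (ψ j + 1)))
    linarith
  have hlim : ∀ z, Tendsto (fun j => (g z).toReal + B * ‖z - x (ψ j + 1)‖) atTop
      (𝓝 ((g z).toReal + B * ‖z - a‖)) := fun z =>
    ((tendsto_const_nhds.sub ha).norm.const_mul B).const_add _
  have hlow : ∀ b : ℝ, (b : EReal) < g a → ∀ᶠ j in atTop, b < (g (x (ψ j + 1))).toReal := by
    intro b hb
    filter_upwards [ha.eventually (hA.lsc_g a b hb)] with j hj
    rw [← hA.proper_g.coe_toReal (hi.g_ne_top hA (ψ j + 1))] at hj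
    exact_mod_cast hj
  have hga : g a ≠ ⊤ := by
    intro htop
    have h1 := hlow ((g z₀).toReal + B * ‖z₀ - a‖ + 1) (by rw [htop]; exact EReal.coe_lt_top _)
    have h2 := (hlim z₀).eventually (gt_mem_nhds (lt_add_one _))
    obtain ⟨j, hj1, hj2⟩ := (h1.and h2).exists
    linarith [hup z₀ hz₀S (ne_of_lt hz₀) j]
  refine ⟨haS, hga, tendsto_order.2 ⟨fun b hb => hlow b ?_, fun b hb => ?_⟩⟩
  · rw [← hA.proper_g.coe_toReal hga]
    exact_mod_cast hb
  · have h1 := hlim a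
    rw [sub_self, norm_zero, mul_zero, add_zero] at h1
    filter_upwards [h1.eventually (gt_mem_nhds hb)] with j hj
    exact (hup a haS hga j).trans_lt hj

theorem IsFPSA.tendsto_phiReal (hi : IsFPSA S g h f K δ σ x y u θ)
    (hA : StandingAssumptions S g h L f K) (hδ : 0 < δ) (hδL : δ * (L : ℝ) < 1) (hσ : 0 < σ)
    (hσ2 : σ < 2) {ψ : ℕ → ℕ} (hψ : Tendsto ψ atTop atTop) {a : E n}
    (ha : Tendsto (fun j => x (ψ j + 1)) atTop (𝓝 a)) :
    Tendsto (fun j => phiReal g h δ (x (ψ j + 1)) (u (ψ j + 1))) atTop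
      (𝓝 ((g a).toReal + h a)) := by
  obtain ⟨haS, hga, hg⟩ := hi.tendsto_g hA hδ hδL hσ hσ2 ha
  have h1 := ((hi.tendsto_x_sub_u hA hδ hδL hσ hσ2).2.comp hψ).norm.pow 2
  have h2 := (hA.hasGradientAt haS).continuousAt.tendsto.comp ha
  have h3 := (hg.add h2).add (h1.const_mul (1 / (2 * δ)))
  simpa [phiReal] using h3

/-- θ converges as a monotone sequence, so one subsequence identifies its limit; the quadratic term
disappears because x - u → 0. -/
theorem IsFPSA.tendsto_theta_of_tendsto (hi : IsFPSA S g h f K δ σ x y u θ)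
    (hA : StandingAssumptions S g h L f K) (hδ : 0 < δ) (hδL : δ * (L : ℝ) < 1) (hσ : 0 < σ)
    (hσ2 : σ < 2) {ψ : ℕ → ℕ} (hψ : Tendsto ψ atTop atTop) {a : E n}
    (ha : Tendsto (fun j => x (ψ j + 1)) atTop (𝓝 a)) :
    Tendsto θ atTop (𝓝 (((g a).toReal + h a) / (f (K a)).toReal)) := by
  obtain ⟨-, ρ, hρ⟩ := hi.exists_tendsto_theta hA hδ hδL hσ hσ2
  have haS := (hi.tendsto_g hA hδ hδL hσ hσ2 ha).1
  have h1 := hi.tendsto_phiReal hA hδ hδL hσ hσ2 hψ ha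
  have h2 : Tendsto (fun j => (f (K (x (ψ j + 1)))).toReal) atTop (𝓝 (f (K a)).toReal) :=
    (hA.continuousAt_f haS).tendsto.comp ((K.continuous.tendsto a).comp ha)
  have h3 := h1.div h2 (hA.toReal_f_pos haS).ne'
  have h4 : Tendsto (fun j => θ (ψ j + 1)) atTop (𝓝 ρ) :=
    hρ.comp ((tendsto_add_atTop_nat 1).comp hψ)
  have h5 : (fun j => θ (ψ j + 1)) = (fun j => phiReal g h δ (x (ψ j + 1)) (u (ψ j + 1))) /
      fun j => (f (K (x (ψ j + 1)))).toReal := by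
    funext j
    exact hi.theta_eq_div hA _
  rw [h5] at h4
  rwa [tendsto_nhds_unique h4 h3] at hρ

theorem IsFPSA.tendsto_x_of_tendsto_succ (hi : IsFPSA S g h f K δ σ x y u θ)
    (hA : StandingAssumptions S g h L f K) (hδ : 0 < δ) (hδL : δ * (L : ℝ) < 1) (hσ : 0 < σ)
    (hσ2 : σ < 2) {ψ : ℕ → ℕ} (hψ : Tendsto ψ atTop atTop) {a : E n}
    (ha : Tendsto (fun j => x (ψ j + 1)) atTop (𝓝 a)) :
    Tendsto (fun j => x (ψ j)) atTop (𝓝 a) := by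
  have := ha.sub ((hi.tendsto_x_sub_x hA hδ hδL hσ hσ2).comp hψ)
  simpa using this

/-- Closedness of the graph of `∂f` along the iterates. -/
theorem IsFPSA.f_subgradient_of_tendsto (hi : IsFPSA S g h f K δ σ x y u θ)
    (hA : StandingAssumptions S g h L f K) {ψ : ℕ → ℕ} {a : E n} {b : E p} (haS : a ∈ S)
    (ha : Tendsto (fun j => x (ψ j)) atTop (𝓝 a))
    (hb : Tendsto (fun j => y (ψ j + 1)) atTop (𝓝 b)) {z : E p} (hz : z ∈ edom f) :
    (f (K a)).toReal + inner ℝ b (z - K a) ≤ (f z).toReal := by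
  have h1 := (K.continuous.tendsto a).comp ha
  have h2 : Tendsto (fun j => (f (K (x (ψ j)))).toReal) atTop (𝓝 (f (K a)).toReal) :=
    (hA.continuousAt_f haS).tendsto.comp h1
  have h3 := h2.add (hb.inner (tendsto_const_nhds (x := z).sub h1))
  exact le_of_tendsto h3 (Eventually.of_forall fun j => hi.f_subgradient hA _ hz)

/-- A limit of the iterates is a lifted stationary point. -/
theorem IsFPSA.isLiftedStationary (hi : IsFPSA S g h f K δ σ x y u θ)
    (hA : StandingAssumptions S g h L f K) (hQ : QualificationCondition S g) (hδ : 0 < δ)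
    (hδL : δ * (L : ℝ) < 1) (hσ : 0 < σ) (hσ2 : σ < 2) {a : E n}
    (ha : Tendsto x atTop (𝓝 a)) : IsLiftedStationary S g h f K a := by
  obtain ⟨B, -, hB⟩ := hi.exists_y_bound hA
  -- The sequence y is only bounded, so a subsequence is extracted.
  obtain ⟨b, ψ, hψ, hb⟩ : ∃ b, ∃ ψ : ℕ → ℕ, StrictMono ψ ∧
      Tendsto ((fun k => y (k + 1)) ∘ ψ) atTop (𝓝 b) := by
    obtain ⟨b, -, ψ, hψ, hb⟩ := tendsto_subseq_of_bounded
      (Metric.isBounded_closedBall (x := (0 : E p)) (r := B)) (x := fun k => y (k + 1))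
      (fun k => by simpa using hB k)
    exact ⟨b, ψ, hψ, hb⟩
  have hψt := hψ.tendsto_atTop
  have ha0 : Tendsto (fun j => x (ψ j)) atTop (𝓝 a) := ha.comp hψt
  have ha1 : Tendsto (fun j => x (ψ j + 1)) atTop (𝓝 a) :=
    ha.comp ((tendsto_add_atTop_nat 1).comp hψt)
  obtain ⟨haS, hga, hg⟩ := hi.tendsto_g hA hδ hδL hσ hσ2 ha1
  set ρ := ((g a).toReal + h a) / (f (K a)).toReal with hρ
  have hθ : Tendsto (fun j => θ (ψ j)) atTop (𝓝 ρ) :=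
    (hi.tendsto_theta_of_tendsto hA hδ hδL hσ hσ2 hψt ha1).comp hψt
  have hbf : b ∈ limitingSubdiff f (K a) := hA.proper_f.mem_limitingSubdiff (hA.f_ne_top haS)
    fun z hz => hi.f_subgradient_of_tendsto hA haS ha0 hb hz
  set c := gradient h a - ρ • (ContinuousLinearMap.adjoint K) b with hc
  have hξ : Tendsto (fun j => proxSubgradient h K δ x y u θ (ψ j)) atTop (𝓝 (-c)) := by
    have h1 : Tendsto (fun j => (1 / δ) • (u (ψ j) - x (ψ j + 1))) atTop (𝓝 0) := by
      have := (((hi.tendsto_x_sub_u hA hδ hδL hσ hσ2).1.comp hψt).neg).const_smul (1 / δ)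
      simpa using this
    have h2 : Tendsto (fun j => gradient h (x (ψ j))) atTop (𝓝 (gradient h a)) :=
      (hA.continuousOn_gradient a haS).tendsto.comp
        (tendsto_nhdsWithin_iff.2 ⟨ha0, Eventually.of_forall fun j => hi.mem _⟩)
    have h3 := hθ.smul (((ContinuousLinearMap.adjoint K).continuous.tendsto b).comp hb)
    have h4 := (h1.sub h2).add h3
    rw [zero_sub] at h4
    rwa [hc, neg_sub, sub_eq_neg_add]
  have hmin : ∀ z ∈ S, g z ≠ ⊤ → (g a).toReal ≤ (g z).toReal + inner ℝ c (z - a) := by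
    intro z hz hgz
    have h1 := hg.add (hξ.inner (tendsto_const_nhds (x := z).sub ha1))
    have h2 := le_of_tendsto h1 (Eventually.of_forall fun j => hi.g_subgradient hA hδ _ hz hgz)
    rw [inner_neg_left] at h2
    linarith
  obtain ⟨ξ, hξm, η, hηm, hsum⟩ :=
    hQ.exists_subgradient_add_normal hA.convex_S hA.proper_g hA.convex_g haS hga hmin
  have hnum : (g a + (h a : EReal)).toReal = ρ * (f (K a)).toReal := by
    rw [EReal.toReal_add hga (hA.proper_g.1 a) (EReal.coe_ne_top _) (EReal.coe_ne_bot _),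
      EReal.toReal_coe, hρ, div_mul_cancel₀ _ (hA.toReal_f_pos haS).ne']
  rw [IsLiftedStationary, Set.mem_sub]
  refine ⟨_, Set.smul_mem_smul_set (Set.add_mem_add (Set.add_mem_add hξm
    (Set.mem_singleton _)) hηm), _, Set.smul_mem_smul_set ⟨b, hbf, rfl⟩, ?_⟩
  -- With ξ + η = -c the bracket equals ρ K*b, and ρ f(K a) = g a + h a cancels it against the
  -- second term.
  rw [hnum, show ξ + gradient h a + η = (ξ + η) + gradient h a by abel, hsum, hc, mul_comm ρ,
    mul_smul, ← smul_sub]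
  simp

end Iteration

/-! ### Norms and inner products on ℓ² products -/

section Product

theorem norm_toLp_prod_le {V W : Type*} [NormedAddCommGroup V] [InnerProductSpace ℝ V]
    [NormedAddCommGroup W] [InnerProductSpace ℝ W] (a : V) (b : W) :
    ‖(WithLp.toLp 2 (a, b) : WithLp 2 (V × W))‖ ≤ ‖a‖ + ‖b‖ := by
  rw [WithLp.prod_norm_eq_of_L2, Real.sqrt_le_left (by positivity)]
  simp only [WithLp.toLp_fst, WithLp.toLp_snd]
  nlinarith [norm_nonneg a, norm_nonneg b]

theorem inner_toLp_prod {V W : Type*} [NormedAddCommGroup V] [InnerProductSpace ℝ V]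
    [NormedAddCommGroup W] [InnerProductSpace ℝ W] (a : V) (b : W) (w : WithLp 2 (V × W)) :
    inner ℝ (WithLp.toLp 2 (a, b)) w = inner ℝ a w.fst + (inner ℝ b w.snd : ℝ) := rfl

theorem continuous_prod_fst {V W : Type*} [NormedAddCommGroup V] [NormedAddCommGroup W] :
    Continuous (fun w : WithLp 2 (V × W) => w.fst) :=
  continuous_fst.comp (WithLp.prod_continuous_ofLp 2 V W)

theorem continuous_prod_snd {V W : Type*} [NormedAddCommGroup V] [NormedAddCommGroup W] :
    Continuous (fun w : WithLp 2 (V × W) => w.snd) :=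
  continuous_snd.comp (WithLp.prod_continuous_ofLp 2 V W)

theorem norm_prod_fst_le {V W : Type*} [NormedAddCommGroup V] [InnerProductSpace ℝ V]
    [NormedAddCommGroup W] [InnerProductSpace ℝ W] (w : WithLp 2 (V × W)) : ‖w.fst‖ ≤ ‖w‖ := by
  rw [WithLp.prod_norm_eq_of_L2]
  exact Real.le_sqrt_of_sq_le (by nlinarith [sq_nonneg ‖w.snd‖])

theorem norm_prod_snd_le {V W : Type*} [NormedAddCommGroup V] [InnerProductSpace ℝ V]
    [NormedAddCommGroup W] [InnerProductSpace ℝ W] (w : WithLp 2 (V × W)) : ‖w.snd‖ ≤ ‖w‖ := by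
  rw [WithLp.prod_norm_eq_of_L2]
  exact Real.le_sqrt_of_sq_le (by nlinarith [sq_nonneg ‖w.fst‖])

theorem toLp_prod_sub_smul {V W : Type*} [NormedAddCommGroup V] [InnerProductSpace ℝ V]
    [NormedAddCommGroup W] [InnerProductSpace ℝ W] (a c : V) (b d : W) (t : ℝ) :
    (WithLp.toLp 2 (a, b) : WithLp 2 (V × W)) - t • WithLp.toLp 2 (c, d)
      = WithLp.toLp 2 (a - t • c, b - t • d) := rfl

end Product

/-! ### Residual estimates common to both cases -/

section Residual

variable {n p : ℕ} {S : Set (E n)} {g : E n → EReal} {h : E n → ℝ} {L : NNReal}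
  {f : E p → EReal} {K : E n →L[ℝ] E p} {δ σ : ℝ}
  {x : ℕ → E n} {y : ℕ → E p} {u : ℕ → E n} {θ : ℕ → ℝ}

/-- First-order lower estimate of `φ` at a point where `ξ` is a subgradient of `g + ι_S`. -/
theorem StandingAssumptions.phiReal_lower (hA : StandingAssumptions S g h L f K) (hδ : 0 < δ)
    {x u ξ : E n} (hx : x ∈ S)
    (hξ : ∀ z ∈ S, g z ≠ ⊤ → (g x).toReal + inner ℝ ξ (z - x) ≤ (g z).toReal)
    {ε : ℝ} (hε : 0 < ε) : ∀ᶠ z in 𝓝 x, ∀ w, z ∈ S → g z ≠ ⊤ →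
      phiReal g h δ x u + (inner ℝ (ξ + gradient h x + (1 / δ) • (x - u)) (z - x)
        + inner ℝ ((1 / δ) • (u - x)) (w - u)) - ε * ‖z - x‖ ≤ phiReal g h δ z w := by
  have h1 := (hasGradientAt_iff_isLittleO.1 (hA.hasGradientAt hx)).def hε
  filter_upwards [h1] with z hz w hzS hgz
  rw [Real.norm_eq_abs] at hz
  have h2 := (abs_le.1 hz).1
  have h3 := hξ z hzS hgz
  have h4 : ‖z - w‖ ^ 2 = ‖x - u‖ ^ 2 + 2 * inner ℝ (x - u) ((z - x) - (w - u))
      + ‖(z - x) - (w - u)‖ ^ 2 := by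
    rw [← norm_add_sq_real]
    congr 2
    abel
  -- The second-order part of the quadratic is dropped, so the estimate is uniform in `w`.
  have h5 : 0 ≤ 1 / (2 * δ) * ‖(z - x) - (w - u)‖ ^ 2 := by positivity
  have h6 : 1 / δ = 2 * (1 / (2 * δ)) := by field_simp
  rw [phiReal, phiReal, h4, inner_add_left, inner_add_left, inner_smul_left, inner_smul_left,
    ← neg_sub x u, inner_neg_left, inner_sub_right (x - u) (z - x) (w - u)]
  simp only [RCLike.conj_to_real]
  rw [h6]
  linarith

/-- Bounds the x-component of a subgradient up to the factor 1/denominator. The proximal terms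
cancel down to differences of consecutive iterates; `t` and `z` stand for the merit value and the
dual vector, which differ between the two cases. -/
theorem IsFPSA.norm_residual_le (hi : IsFPSA S g h f K δ σ x y u θ)
    (hA : StandingAssumptions S g h L f K) (hδ : 0 < δ) (k : ℕ) (t : ℝ) (z : E p) :
    ‖proxSubgradient h K δ x y u θ k + gradient h (x (k + 1))
        + (1 / δ) • (x (k + 1) - u (k + 1)) - t • (ContinuousLinearMap.adjoint K) z‖
      ≤ (1 / δ + L) * stepLength x u k
        + ‖ContinuousLinearMap.adjoint K‖ * ‖θ k • y (k + 1) - t • z‖ := by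
  have e : proxSubgradient h K δ x y u θ k + gradient h (x (k + 1))
        + (1 / δ) • (x (k + 1) - u (k + 1)) - t • (ContinuousLinearMap.adjoint K) z
      = (1 / δ) • (u k - u (k + 1)) + (gradient h (x (k + 1)) - gradient h (x k))
        + (ContinuousLinearMap.adjoint K) (θ k • y (k + 1) - t • z) := by
    rw [proxSubgradient, map_sub, map_smul, map_smul]
    module
  have h1 : ‖(1 / δ) • (u k - u (k + 1))‖ ≤ 1 / δ * stepLength x u k := by
    rw [norm_smul, Real.norm_of_nonneg (by positivity), stepLength]
    gcongr
    linarith [norm_nonneg (x k - x (k + 1))]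
  have h2 : ‖gradient h (x (k + 1)) - gradient h (x k)‖ ≤ L * stepLength x u k := by
    refine (hA.norm_gradient_sub_le (hi.x_mem k) (hi.mem k)).trans ?_
    rw [norm_sub_rev, stepLength]
    gcongr
    linarith [norm_nonneg (u k - u (k + 1))]
  have h3 := (ContinuousLinearMap.adjoint K).le_opNorm (θ k • y (k + 1) - t • z)
  rw [e]
  refine (norm_add_le _ _).trans (add_le_add ((norm_add_le _ _).trans ?_) h3)
  linarith

theorem IsFPSA.norm_residual_u_le (hi : IsFPSA S g h f K δ σ x y u θ) (hδ : 0 < δ) (hσ : 0 < σ)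
    (hσ2 : σ < 2) (k : ℕ) :
    ‖(1 / δ) • (u (k + 1) - x (k + 1))‖ ≤ 1 / δ * (1 / σ) * stepLength x u k := by
  rw [norm_smul, Real.norm_of_nonneg (by positivity), mul_assoc, norm_sub_rev]
  gcongr
  exact hi.norm_x_sub_u_succ_le hσ hσ2 k

theorem norm_K_sub_le (K : E n →L[ℝ] E p) (x u : ℕ → E n) (k : ℕ) :
    ‖K (x (k + 1)) - K (x k)‖ ≤ ‖K‖ * stepLength x u k := by
  rw [← map_sub]
  refine (K.le_opNorm _).trans ?_
  rw [norm_sub_rev, stepLength]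
  gcongr
  linarith [norm_nonneg (u k - u (k + 1))]

theorem IsFPSA.exists_iterate_bound (hi : IsFPSA S g h f K δ σ x y u θ)
    (hA : StandingAssumptions S g h L f K) (hδ : 0 < δ) (hδL : δ * (L : ℝ) < 1) (hσ : 0 < σ)
    (hσ2 : σ < 2) : ∃ B : ℝ, ∀ k, ‖x (k + 1)‖ + ‖u (k + 1)‖ ≤ B := by
  obtain ⟨B₁, hB₁⟩ := hA.compact_S.isBounded.exists_norm_le
  obtain ⟨B₂, hB₂⟩ := (Metric.isBounded_range_of_tendsto _
    (hi.tendsto_x_sub_u hA hδ hδL hσ hσ2).2).exists_norm_le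
  refine ⟨B₁ + (B₁ + B₂), fun k => add_le_add (hB₁ _ (hi.x_mem k)) ?_⟩
  have h1 : u (k + 1) = x (k + 1) - (x (k + 1) - u (k + 1)) := by abel
  rw [h1]
  exact (norm_sub_le _ _).trans (add_le_add (hB₁ _ (hi.x_mem k)) (hB₂ _ ⟨k, rfl⟩))

theorem StandingAssumptions.exists_f_ge (hA : StandingAssumptions S g h L f K) :
    ∃ m : ℝ, 0 < m ∧ ∀ a ∈ S, m ≤ (f (K a)).toReal := by
  have hc : ContinuousOn (fun a => (f (K a)).toReal) S := fun a ha =>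
    ((hA.continuousAt_f ha).comp (f := K) K.continuous.continuousAt).continuousWithinAt
  obtain ⟨b, hb, hmin⟩ := hA.compact_S.exists_isMinOn hA.nonempty_S hc
  exact ⟨_, hA.toReal_f_pos hb, fun a ha => hmin ha⟩

end Residual

/-! ### Case (ii): `f` smooth, merit function ϑ -/

section Smooth

variable {n p : ℕ} {S : Set (E n)} {g : E n → EReal} {h : E n → ℝ} {L : NNReal}
  {f : E p → EReal} {K : E n →L[ℝ] E p} {δ σ : ℝ}
  {x : ℕ → E n} {y : ℕ → E p} {u : ℕ → E n} {θ : ℕ → ℝ}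

theorem StandingAssumptions.varthetaFun_eq (hA : StandingAssumptions S g h L f K)
    {w : WithLp 2 (E n × E n)} (hx : w.fst ∈ S) (hgx : g w.fst ≠ ⊤) :
    varthetaFun S g h f K δ w
      = ((phiReal g h δ w.fst w.snd / (f (K w.fst)).toReal : ℝ) : EReal) := by
  rw [varthetaFun, vartheta, hA.phi_eq hx hgx, if_neg (EReal.coe_ne_top _), ← hA.coe_f hx,
    ← EReal.coe_div, EReal.toReal_coe]

/-- Fréchet subgradients of `ϑ` when `f` is differentiable. -/
theorem StandingAssumptions.mem_frechetSubdiff_varthetaFun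
    (hA : StandingAssumptions S g h L f K) (hδ : 0 < δ) {x u ξ : E n} {v : E p} (hx : x ∈ S)
    (hgx : g x ≠ ⊤)
    (hξ : ∀ z ∈ S, g z ≠ ⊤ → (g x).toReal + inner ℝ ξ (z - x) ≤ (g z).toReal)
    (hf : HasGradientAt (fun z => (f z).toReal) v (K x)) :
    (1 / (f (K x)).toReal) • ((WithLp.toLp 2 (ξ + gradient h x + (1 / δ) • (x - u),
        (1 / δ) • (u - x)) : WithLp 2 (E n × E n))
      - (phiReal g h δ x u / (f (K x)).toReal) •
        WithLp.toLp 2 ((ContinuousLinearMap.adjoint K) v, 0))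
      ∈ frechetSubdiff (varthetaFun S g h f K δ) (WithLp.toLp 2 (x, u)) := by
  refine mem_frechetSubdiff_div (w₀ := WithLp.toLp 2 (x, u))
    (P := {w : WithLp 2 (E n × E n) | w.fst ∈ S ∧ g w.fst ≠ ⊤})
    (N := fun w => phiReal g h δ w.fst w.snd) (G := fun w => (f (K w.fst)).toReal)
    ⟨hx, hgx⟩ (fun w hw => ?_) (fun w hw => hA.varthetaFun_eq hw.1 hw.2)
    (fun w hw => hA.toReal_f_pos hw.1) (hA.phiReal_nonneg hδ hx hgx u) (fun ε hε => ?_)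
    (fun ε hε => ?_) ?_
  · rw [varthetaFun, vartheta, if_pos (hA.phi_eq_top hw _)]
  · have h1 := hA.phiReal_lower hδ (u := u) hx hξ hε
    have h2 : Tendsto (fun w : WithLp 2 (E n × E n) => w.fst) (𝓝 (WithLp.toLp 2 (x, u)))
        (𝓝 x) := continuous_prod_fst.tendsto _
    filter_upwards [h2.eventually h1] with w hw hP
    have h3 := hw w.snd hP.1 hP.2
    have h4 := norm_prod_fst_le (w - WithLp.toLp 2 (x, u))
    rw [inner_toLp_prod]
    simp only [WithLp.sub_fst, WithLp.sub_snd, WithLp.toLp_fst, WithLp.toLp_snd] at h4 ⊢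
    nlinarith
  · have h1 := (hasGradientAt_iff_isLittleO.1 hf).def
      (show 0 < ε / (‖K‖ + 1) by positivity)
    have h2 : Tendsto (fun w : WithLp 2 (E n × E n) => K w.fst) (𝓝 (WithLp.toLp 2 (x, u)))
        (𝓝 (K x)) := (K.continuous.comp continuous_prod_fst).tendsto _
    filter_upwards [h2.eventually h1] with w hw hP
    have h3 := (abs_le.1 hw).2
    have h4 := norm_prod_fst_le (w - WithLp.toLp 2 (x, u))
    rw [inner_toLp_prod]
    simp only [WithLp.sub_fst, WithLp.sub_snd, WithLp.toLp_fst, WithLp.toLp_snd,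
      inner_zero_left, add_zero, ContinuousLinearMap.adjoint_inner_left] at h3 h4 ⊢
    rw [← map_sub] at h3
    have h5 : ε / (‖K‖ + 1) * ‖K (w.fst - x)‖ ≤ ε * ‖w - WithLp.toLp 2 (x, u)‖ := by
      calc ε / (‖K‖ + 1) * ‖K (w.fst - x)‖
          ≤ ε / (‖K‖ + 1) * ((‖K‖ + 1) * ‖w - WithLp.toLp 2 (x, u)‖) := by
            gcongr
            refine (K.le_opNorm _).trans ?_
            gcongr
            linarith
        _ = _ := by field_simp
    linarith
  · exact (hA.continuousAt_f hx).tendsto.comp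
      (((K.continuous.comp continuous_prod_fst).tendsto _).mono_left nhdsWithin_le_nhds)

/-- F - ⟨v, ·⟩ has a local minimum at `a`, so its derivative vanishes there. -/
theorem HasGradientAt.eq_of_subgradient {F : E p → ℝ} {a v w : E p} (hF : HasGradientAt F w a)
    (hv : ∀ᶠ z in 𝓝 a, F a + inner ℝ v (z - a) ≤ F z) : v = w := by
  have h1 : IsLocalMin (fun z => F z - inner ℝ v z) a := by
    filter_upwards [hv] with z hz
    rw [inner_sub_right] at hz
    linarith
  have h2 : HasFDerivAt (fun z => F z - inner ℝ v z)
      (InnerProductSpace.toDual ℝ (E p) w - innerSL ℝ v) a :=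
    hF.hasFDerivAt.sub (innerSL ℝ v).hasFDerivAt
  have h3 := h1.hasFDerivAt_eq_zero h2
  refine (ext_inner_right ℝ fun z => ?_)
  have h4 := DFunLike.congr_fun h3 z
  simp at h4
  linarith

theorem IsFPSA.summable_of_smooth (hi : IsFPSA S g h f K δ σ x y u θ)
    (hA : StandingAssumptions S g h L f K) (hδ : 0 < δ) (hδL : δ * (L : ℝ) < 1) (hσ : 0 < σ)
    (hσ2 : σ < 2) (hsm : SmoothNear f (K '' S)) (hKL : HasKL (varthetaFun S g h f K δ)) :
    Summable (stepLength x u) := by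
  obtain ⟨O, hO, hKO, -, hd, Cf, hCf⟩ := hsm
  set F : E p → ℝ := fun z => (f z).toReal with hF
  have hgrad : ∀ a ∈ S, HasGradientAt F (gradient F (K a)) (K a) := fun a ha =>
    (hd.differentiableAt (hO.mem_nhds (hKO ⟨a, ha, rfl⟩))).hasGradientAt
  have hy : ∀ k, y (k + 1) = gradient F (K (x k)) := fun k => by
    refine HasGradientAt.eq_of_subgradient (hgrad _ (hi.mem k)) ?_
    filter_upwards [isOpen_interior.mem_nhds (hA.image_subset ⟨_, hi.mem k, rfl⟩)] with z hz
    exact hi.f_subgradient hA k (interior_subset hz)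
  obtain ⟨c, hc, hdec⟩ := hi.exists_theta_descent hA hδ hδL hσ hσ2
  obtain ⟨hanti, ρ, hρ⟩ := hi.exists_tendsto_theta hA hδ hδL hσ hσ2
  obtain ⟨m, hm, hfm⟩ := hA.exists_f_ge
  obtain ⟨B, hB0, hB⟩ := hi.exists_y_bound hA
  obtain ⟨R, hR⟩ := hi.exists_iterate_bound hA hδ hδL hσ hσ2
  have hθ0 := hi.theta_nonneg hA hδ
  set κ := ‖ContinuousLinearMap.adjoint K‖ with hκ
  have hκ0 : 0 ≤ κ := norm_nonneg _
  set C := 1 / m * (1 / δ + L + κ * (θ 0 * (Cf * ‖K‖)) + κ * B + 1 / δ * (1 / σ)) with hC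
  rw [← summable_nat_add_iff 1]
  -- Indices are shifted by one because the proximal subgradient lives at x (k + 1); no subgradient
  -- at x 0 is available.
  refine hKL.summable (w := fun k => WithLp.toLp 2 (x (k + 1), u (k + 1)))
    (v := fun k => (1 / F (K (x (k + 1)))) •
      ((WithLp.toLp 2 (proxSubgradient h K δ x y u θ k + gradient h (x (k + 1))
        + (1 / δ) • (x (k + 1) - u (k + 1)), (1 / δ) • (u (k + 1) - x (k + 1))) :
          WithLp 2 (E n × E n))
      - (phiReal g h δ (x (k + 1)) (u (k + 1)) / F (K (x (k + 1)))) •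
        WithLp.toLp 2 ((ContinuousLinearMap.adjoint K) (gradient F (K (x (k + 1)))), 0)))
    (r := fun k => θ (k + 1)) (C := C) (isCompact_closedBall 0 R) (fun k => ?_) (fun k => ?_)
    ((tendsto_add_atTop_iff_nat 1).2 hρ) hc ?_ (fun k => stepLength_nonneg _ _ _)
    (fun k => hdec _) (fun k => ?_) (fun k => ?_) ?_
  · rw [mem_closedBall_zero_iff]
    exact (norm_toLp_prod_le _ _).trans (hR k)
  · rw [hi.theta_eq k.succ]
    rfl
  · rw [hC]
    have := hθ0 0
    positivity
  · exact hA.mem_frechetSubdiff_varthetaFun hδ (hi.x_mem k) (hi.g_ne_top hA _)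
      (fun z hz hgz => hi.g_subgradient hA hδ k hz hgz) (hgrad _ (hi.x_mem k))
  · rw [← hi.theta_eq_div hA, ← hy]
    generalize k + 1 = k
    have hFm := hfm _ (hi.x_mem k)
    have hs := stepLength_nonneg x u k
    have hθk : 0 ≤ θ k - θ (k + 1) := sub_nonneg.2 (hanti (Nat.le_succ k))
    have h1 : ‖θ k • y (k + 1) - θ (k + 1) • y (k + 1 + 1)‖
        ≤ θ 0 * (Cf * ‖K‖) * stepLength x u k + B * (θ k - θ (k + 1)) := by
      -- Lipschitz continuity of ∇f bounds the first part by the step length; the change of θ is the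
      -- decrease term in the relative error condition.
      have e : θ k • y (k + 1) - θ (k + 1) • y (k + 1 + 1)
          = θ k • (y (k + 1) - y (k + 1 + 1)) + (θ k - θ (k + 1)) • y (k + 1 + 1) := by module
      rw [e]
      refine (norm_add_le _ _).trans (add_le_add ?_ ?_)
      · rw [norm_smul, Real.norm_of_nonneg (hθ0 k), mul_assoc]
        refine mul_le_mul (hanti (Nat.zero_le k)) ?_ (norm_nonneg _) (hθ0 0)
        rw [hy, hy, mul_assoc]
        refine (hCf.norm_sub_le (hKO ⟨_, hi.mem k, rfl⟩) (hKO ⟨_, hi.mem (k + 1), rfl⟩)).trans ?_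
        rw [norm_sub_rev]
        gcongr
        exact norm_K_sub_le K x u k
      · rw [norm_smul, Real.norm_of_nonneg hθk, mul_comm]
        gcongr
        exact hB _
    have h2 := hi.norm_residual_le hA hδ k (θ (k + 1)) (y (k + 1 + 1))
    have h3 := hi.norm_residual_u_le hδ hσ hσ2 k
    have h4 := mul_le_mul_of_nonneg_left h1 hκ0
    have e2 : (WithLp.toLp 2 (proxSubgradient h K δ x y u θ k + gradient h (x (k + 1))
        + (1 / δ) • (x (k + 1) - u (k + 1)), (1 / δ) • (u (k + 1) - x (k + 1))) :
          WithLp 2 (E n × E n)) - θ (k + 1) •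
          WithLp.toLp 2 ((ContinuousLinearMap.adjoint K) (y (k + 1 + 1)), 0)
        = WithLp.toLp 2 (proxSubgradient h K δ x y u θ k + gradient h (x (k + 1))
        + (1 / δ) • (x (k + 1) - u (k + 1))
          - θ (k + 1) • (ContinuousLinearMap.adjoint K) (y (k + 1 + 1)),
          (1 / δ) • (u (k + 1) - x (k + 1))) := by
      rw [toLp_prod_sub_smul, smul_zero, sub_zero]
    rw [e2, norm_smul, Real.norm_of_nonneg (by
      exact one_div_nonneg.2 (hm.le.trans hFm)), hC, mul_assoc]
    refine mul_le_mul (one_div_le_one_div_of_le hm hFm)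
      ((norm_toLp_prod_le _ _).trans ((add_le_add h2 h3).trans ?_)) (norm_nonneg _)
      (by positivity)
    -- Padding, so that the single constant `C` multiplies both the step length and the decrease.
    have t1 : 0 ≤ (1 / δ + L + κ * (θ 0 * (Cf * ‖K‖)) + 1 / δ * (1 / σ))
        * (θ k - θ (k + 1)) := by
      have := hθ0 0
      positivity
    have t2 : 0 ≤ κ * B * stepLength x u k := by positivity
    nlinarith
  · intro ψ a hψ ha
    have ha1 : Tendsto (fun j => x (ψ j + 1)) atTop (𝓝 a.fst) :=
      (continuous_prod_fst.tendsto a).comp ha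
    have ha2 : Tendsto (fun j => u (ψ j + 1)) atTop (𝓝 a.snd) :=
      (continuous_prod_snd.tendsto a).comp ha
    have hψt := hψ.tendsto_atTop
    obtain ⟨haS, hga, -⟩ := hi.tendsto_g hA hδ hδL hσ hσ2 ha1
    have h1 : a.fst - a.snd = 0 := tendsto_nhds_unique (ha1.sub ha2)
      ((hi.tendsto_x_sub_u hA hδ hδL hσ hσ2).2.comp hψt)
    rw [hA.varthetaFun_eq haS hga, tendsto_nhds_unique hρ
      (hi.tendsto_theta_of_tendsto hA hδ hδL hσ hσ2 hψt ha1), phiReal, h1]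
    simp

end Smooth

/-! ### Conjugates, calmness and Fenchel–Young -/

section Conjugate

/-- Continuity of f* at yₖ is the only consequence of calmness that is used. -/
theorem CalmAt.continuousAt_toReal {V : Type*} [NormedAddCommGroup V] {f : V → EReal} {a : V}
    (h : CalmAt f a) :
    ContinuousAt (fun z => (f z).toReal) a := by
  obtain ⟨h1, h2, ρ, hρ, ε, hε, hcalm⟩ := h
  have hlim : Tendsto (fun z => ρ * ‖a - z‖) (𝓝 a) (𝓝 0) := by
    have : Tendsto (fun z => ρ * ‖a - z‖) (𝓝 a) (𝓝 (ρ * ‖a - a‖)) :=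
      Continuous.tendsto (by fun_prop) a
    simpa using this
  refine tendsto_iff_dist_tendsto_zero.2
    (squeeze_zero' (Eventually.of_forall fun z => dist_nonneg) ?_ hlim)
  filter_upwards [Metric.ball_mem_nhds a hε] with z hz
  have h3 := hcalm z hz
  have hne : (f a - f z).abs ≠ ⊤ := ne_top_of_le_ne_top ENNReal.ofReal_ne_top h3
  have hzt : f z ≠ ⊤ := by
    intro hz
    rw [hz, ← EReal.coe_toReal h1 h2, EReal.sub_top, EReal.abs_bot] at hne
    exact hne rfl
  have hzb : f z ≠ ⊥ := by
    intro hz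
    rw [hz, ← EReal.coe_toReal h1 h2, EReal.coe_sub_bot, EReal.abs_top] at hne
    exact hne rfl
  rw [← EReal.coe_toReal h1 h2, ← EReal.coe_toReal hzt hzb, ← EReal.coe_sub, EReal.abs_def,
    ENNReal.ofReal_le_ofReal_iff (by positivity)] at h3
  rwa [Real.dist_eq, abs_sub_comm]

variable {V : Type*} [NormedAddCommGroup V] [InnerProductSpace ℝ V] {f : V → EReal}

theorem IsProper.conjugate_ne_bot (hf : IsProper f) (v : V) : conjugate f v ≠ ⊥ := by
  obtain ⟨z, hz⟩ := hf.2
  have h1 : ((inner ℝ z v : ℝ) : EReal) - f z ≤ conjugate f v :=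
    le_iSup (fun z : V => ((inner ℝ z v : ℝ) : EReal) - f z) z
  rw [← hf.coe_toReal hz, ← EReal.coe_sub] at h1
  exact ne_bot_of_le_ne_bot (EReal.coe_ne_bot _) h1

/-- The Fenchel–Young inequality. -/
theorem IsProper.le_toReal_conjugate (hf : IsProper f) {v z : V} (hz : f z ≠ ⊤)
    (hv : conjugate f v ≠ ⊤) : inner ℝ z v - (f z).toReal ≤ (conjugate f v).toReal := by
  have h1 : ((inner ℝ z v : ℝ) : EReal) - f z ≤ conjugate f v :=
    le_iSup (fun z : V => ((inner ℝ z v : ℝ) : EReal) - f z) z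
  rw [← hf.coe_toReal hz, ← EReal.coe_sub,
    ← EReal.coe_toReal hv (hf.conjugate_ne_bot v)] at h1
  exact_mod_cast h1

/-- Equality in the Fenchel–Young inequality at a subgradient. -/
theorem IsProper.conjugate_eq (hf : IsProper f) {a v : V} (ha : f a ≠ ⊤)
    (h : ∀ z ∈ edom f, (f a).toReal + inner ℝ v (z - a) ≤ (f z).toReal) :
    conjugate f v = ((inner ℝ a v - (f a).toReal : ℝ) : EReal) := by
  refine le_antisymm (iSup_le fun z => ?_) ?_
  · by_cases hz : f z = ⊤
    · rw [hz, EReal.sub_top]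
      exact bot_le
    · have h1 := h z (lt_top_iff_ne_top.2 hz)
      rw [inner_sub_right, real_inner_comm, real_inner_comm a v] at h1
      rw [← hf.coe_toReal hz, ← EReal.coe_sub, EReal.coe_le_coe_iff]
      linarith
  · rw [EReal.coe_sub, hf.coe_toReal ha]
    exact le_iSup (fun z : V => ((inner ℝ z v : ℝ) : EReal) - f z) a

end Conjugate

/-! ### Case (i): `f*` calm, merit function ϖ -/

section Calm

variable {n p : ℕ} {S : Set (E n)} {g : E n → EReal} {h : E n → ℝ} {L : NNReal}
  {f : E p → EReal} {K : E n →L[ℝ] E p} {δ σ m : ℝ}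
  {x : ℕ → E n} {y : ℕ → E p} {u : ℕ → E n} {θ : ℕ → ℝ}

/-- The real denominator `⟨K x, y⟩ - f* y` of `ϖ`. -/
noncomputable def fenchelReal (f : E p → EReal) (K : E n →L[ℝ] E p) (x : E n) (y : E p) : ℝ :=
  inner ℝ (K x) y - (conjugate f y).toReal

theorem IsProper.coe_fenchelReal (hf : IsProper f) {y : E p} (hy : conjugate f y ≠ ⊤)
    (x : E n) : ((inner ℝ (K x) y : ℝ) : EReal) - conjugate f y = (fenchelReal f K x y : ℝ) := by
  rw [fenchelReal, EReal.coe_sub, EReal.coe_toReal hy (hf.conjugate_ne_bot y)]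

theorem lt_sub_conjugate_iff (hf : IsProper f) (x : E n) (y : E p) :
    ((m / 2 : ℝ) : EReal) < ((inner ℝ (K x) y : ℝ) : EReal) - conjugate f y ↔
      conjugate f y ≠ ⊤ ∧ m / 2 < fenchelReal f K x y := by
  by_cases hy : conjugate f y = ⊤
  · simp [hy]
  · rw [hf.coe_fenchelReal hy, EReal.coe_lt_coe_iff]
    simp [hy]

/-- The domain of `ϖ`. -/
def varpiDomain (S : Set (E n)) (g : E n → EReal) (f : E p → EReal) (K : E n →L[ℝ] E p) (m : ℝ) :
    Set (WithLp 2 (E n × WithLp 2 (E p × E n))) :=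
  {w | w.fst ∈ S ∧ g w.fst ≠ ⊤ ∧ conjugate f w.snd.fst ≠ ⊤ ∧
    m / 2 < fenchelReal f K w.fst w.snd.fst}

theorem StandingAssumptions.varpiFun_eq (hA : StandingAssumptions S g h L f K)
    {w : WithLp 2 (E n × WithLp 2 (E p × E n))} (hw : w ∈ varpiDomain S g f K m) :
    varpiFun S g h f K δ m w = ((phiReal g h δ w.fst w.snd.snd /
      fenchelReal f K w.fst w.snd.fst : ℝ) : EReal) := by
  obtain ⟨h1, h2, h3, h4⟩ := hw
  rw [varpiFun, varpi, if_pos ((lt_sub_conjugate_iff hA.proper_f _ _).2 ⟨h3, h4⟩),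
    hA.phi_eq h1 h2, hA.proper_f.coe_fenchelReal h3, ← EReal.coe_div]

theorem StandingAssumptions.varpiFun_eq_top (hA : StandingAssumptions S g h L f K) (hm : 0 < m)
    {w : WithLp 2 (E n × WithLp 2 (E p × E n))} (hw : w ∉ varpiDomain S g f K m) :
    varpiFun S g h f K δ m w = ⊤ := by
  rw [varpiFun, varpi]
  split_ifs with h1
  · obtain ⟨h3, h4⟩ := (lt_sub_conjugate_iff hA.proper_f _ _).1 h1
    rw [hA.phi_eq_top (fun hx => hw ⟨hx.1, hx.2, h3, h4⟩), hA.proper_f.coe_fenchelReal h3]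
    refine EReal.top_div_of_pos_ne_top ?_ (EReal.coe_ne_top _)
    have : 0 < fenchelReal f K w.fst w.snd.fst := by linarith
    exact_mod_cast this
  · rfl

/-- Fréchet subgradients of `ϖ` at a point where `f*` is continuous and has the subgradient
`z`. -/
theorem StandingAssumptions.mem_frechetSubdiff_varpiFun
    (hA : StandingAssumptions S g h L f K) (hδ : 0 < δ) (hm : 0 < m) {x u ξ : E n} {y z : E p}
    (hw : WithLp.toLp 2 (x, WithLp.toLp 2 (y, u)) ∈ varpiDomain S g f K m)
    (hξ : ∀ z ∈ S, g z ≠ ⊤ → (g x).toReal + inner ℝ ξ (z - x) ≤ (g z).toReal)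
    (hz : f z ≠ ⊤) (hyz : (conjugate f y).toReal = inner ℝ z y - (f z).toReal)
    (hcont : ContinuousAt (fun y => (conjugate f y).toReal) y) :
    (1 / fenchelReal f K x y) • ((WithLp.toLp 2 (ξ + gradient h x + (1 / δ) • (x - u),
        WithLp.toLp 2 (0, (1 / δ) • (u - x))) : WithLp 2 (E n × WithLp 2 (E p × E n)))
      - (phiReal g h δ x u / fenchelReal f K x y) •
        WithLp.toLp 2 ((ContinuousLinearMap.adjoint K) y, WithLp.toLp 2 (K x - z, 0)))
      ∈ frechetSubdiff (varpiFun S g h f K δ m)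
        (WithLp.toLp 2 (x, WithLp.toLp 2 (y, u))) := by
  set w₀ : WithLp 2 (E n × WithLp 2 (E p × E n)) :=
    WithLp.toLp 2 (x, WithLp.toLp 2 (y, u)) with hw₀
  have hcK : Continuous fun w : WithLp 2 (E n × WithLp 2 (E p × E n)) => K w.fst :=
    K.continuous.comp continuous_prod_fst
  have hcy : Continuous fun w : WithLp 2 (E n × WithLp 2 (E p × E n)) => w.snd.fst :=
    continuous_prod_fst.comp continuous_prod_snd
  refine mem_frechetSubdiff_div (w₀ := w₀) (P := varpiDomain S g f K m)
    (N := fun w => phiReal g h δ w.fst w.snd.snd)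
    (G := fun w => fenchelReal f K w.fst w.snd.fst)
    hw (fun w hw => hA.varpiFun_eq_top hm hw) (fun w hw => hA.varpiFun_eq hw)
    (fun w hw => by linarith [hw.2.2.2]) (hA.phiReal_nonneg hδ hw.1 hw.2.1 u) (fun ε hε => ?_)
    (fun ε hε => ?_) ?_
  · have hx : x ∈ S := hw.1
    have h1 := hA.phiReal_lower hδ (u := u) hx hξ hε
    have h2 : Tendsto (fun w : WithLp 2 (E n × WithLp 2 (E p × E n)) => w.fst) (𝓝 w₀)
        (𝓝 x) := continuous_prod_fst.tendsto _
    filter_upwards [h2.eventually h1] with w hw hP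
    have h3 := hw w.snd.snd hP.1 hP.2.1
    have h4 := norm_prod_fst_le (w - w₀)
    rw [inner_toLp_prod, inner_toLp_prod]
    simp only [hw₀, WithLp.sub_fst, WithLp.sub_snd, WithLp.toLp_fst, WithLp.toLp_snd,
      inner_zero_left, zero_add] at h4 ⊢
    nlinarith
  · have h1 : ∀ᶠ w in 𝓝 w₀, ‖w - w₀‖ < ε / (‖K‖ + 1) := by
      have := Metric.ball_mem_nhds w₀ (show 0 < ε / (‖K‖ + 1) by positivity)
      filter_upwards [this] with w hw
      simpa [dist_eq_norm] using hw
    filter_upwards [h1] with w hw hP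
    -- Fenchel–Young at the fixed point `z` bounds the denominator above by a bilinear expression,
    -- with equality at the base point by `hyz`. Its second-order remainder ⟨K(x' - x), y' - y⟩ is
    -- absorbed by the radius ε/(‖K‖ + 1).
    have h2 := hA.proper_f.le_toReal_conjugate hz hP.2.2.1
    have h3 := (norm_prod_fst_le (w - w₀))
    have h4 := (norm_prod_fst_le (w - w₀).snd).trans (norm_prod_snd_le (w - w₀))
    have h5 := real_inner_le_norm (K (w.fst - x)) (w.snd.fst - y)
    have h6 := K.le_opNorm (w.fst - x)
    rw [inner_toLp_prod, inner_toLp_prod]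
    simp only [hw₀, WithLp.sub_fst, WithLp.sub_snd, WithLp.toLp_fst, WithLp.toLp_snd,
      inner_zero_left, add_zero, ContinuousLinearMap.adjoint_inner_left, fenchelReal] at h3 h4 ⊢
    rw [← hw₀] at h3 h4 ⊢
    have h7 : ‖K (w.fst - x)‖ * ‖w.snd.fst - y‖ ≤ ε * ‖w - w₀‖ := by
      calc ‖K (w.fst - x)‖ * ‖w.snd.fst - y‖
          ≤ (‖K‖ * ‖w - w₀‖) * ‖w - w₀‖ := by
            gcongr
            exact h6.trans (by gcongr)
        _ ≤ ((‖K‖ + 1) * (ε / (‖K‖ + 1))) * ‖w - w₀‖ := by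
            gcongr
            linarith
        _ = ε * ‖w - w₀‖ := by field_simp
    have h8 : inner ℝ (K w.fst) w.snd.fst - inner ℝ z w.snd.fst
        = inner ℝ (K x) y - inner ℝ z y + (inner ℝ y (K (w.fst - x))
          + inner ℝ (K x - z) (w.snd.fst - y)) + inner ℝ (K (w.fst - x)) (w.snd.fst - y) := by
      rw [map_sub]
      simp only [inner_sub_left, inner_sub_right]
      rw [real_inner_comm (K w.fst) y, real_inner_comm (K x) y]
      ring
    rw [hyz]
    linarith
  · have h1 : ContinuousAt (fun w : WithLp 2 (E n × WithLp 2 (E p × E n)) =>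
        (conjugate f w.snd.fst).toReal) w₀ :=
      ContinuousAt.comp (f := fun w : WithLp 2 (E n × WithLp 2 (E p × E n)) => w.snd.fst)
        (g := fun y => (conjugate f y).toReal) hcont hcy.continuousAt
    have h2 : ContinuousAt (fun w : WithLp 2 (E n × WithLp 2 (E p × E n)) =>
        fenchelReal f K w.fst w.snd.fst) w₀ :=
      (hcK.continuousAt.inner hcy.continuousAt).sub h1
    exact h2.tendsto.mono_left nhdsWithin_le_nhds

theorem IsFPSA.conjugate_eq (hi : IsFPSA S g h f K δ σ x y u θ)
    (hA : StandingAssumptions S g h L f K) (k : ℕ) :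
    conjugate f (y (k + 1))
      = ((inner ℝ (K (x k)) (y (k + 1)) - (f (K (x k))).toReal : ℝ) : EReal) :=
  hA.proper_f.conjugate_eq (hA.f_ne_top (hi.mem k)) fun _ hz => hi.f_subgradient hA k hz

/-- Links ϖ to the algorithm: the linearization of `f` in the descent estimate is the denominator of
ϖ at the new iterate. -/
theorem IsFPSA.fenchelReal_eq (hi : IsFPSA S g h f K δ σ x y u θ)
    (hA : StandingAssumptions S g h L f K) (k : ℕ) :
    fenchelReal f K (x (k + 1)) (y (k + 1))
      = (f (K (x k))).toReal + inner ℝ (y (k + 1)) (K (x (k + 1)) - K (x k)) := by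
  rw [fenchelReal, hi.conjugate_eq hA, EReal.toReal_coe, inner_sub_right, real_inner_comm,
    real_inner_comm (K (x k))]
  ring

theorem IsFPSA.summable_of_calm (hi : IsFPSA S g h f K δ σ x y u θ)
    (hA : StandingAssumptions S g h L f K) (hδ : 0 < δ) (hδL : δ * (L : ℝ) < 1) (hσ : 0 < σ)
    (hσ2 : σ < 2) (hcalm : ∀ᶠ k in atTop, CalmAt (conjugate f) (y k)) (hm : 0 < m)
    (hmf : (m : EReal) < ⨅ k, f (K (x k))) (hKL : HasKL (varpiFun S g h f K δ m)) :
    Summable (stepLength x u) := by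
  obtain ⟨c, hc, hdec⟩ := hi.exists_descent hA hδ hδL hσ hσ2
  obtain ⟨hanti, ρ, hρ⟩ := hi.exists_tendsto_theta hA hδ hδL hσ hσ2
  obtain ⟨M, hM, hfM⟩ := hA.exists_f_le
  obtain ⟨B, hB0, hB⟩ := hi.exists_y_bound hA
  obtain ⟨R, hR⟩ := hi.exists_iterate_bound hA hδ hδL hσ hσ2
  have hθ0 := hi.theta_nonneg hA hδ
  have hmfk : ∀ k, m < (f (K (x k))).toReal := fun k => by
    have h1 : (m : EReal) < f (K (x k)) := hmf.trans_le (iInf_le _ k)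
    rw [← hA.coe_f (hi.mem k)] at h1
    exact_mod_cast h1
  set G : ℕ → ℝ := fun k => fenchelReal f K (x (k + 1)) (y (k + 1)) with hG
  -- f(K xₖ) exceeds `m` and the linear correction tends to 0, so late iterates lie in the domain of
  -- ϖ.
  have hGev : ∀ᶠ k in atTop, m / 2 < G k := by
    have h1 : Tendsto (fun k => B * ‖K (x (k + 1) - x k)‖) atTop (𝓝 0) := by
      have := ((K.continuous.tendsto 0).comp
        (hi.tendsto_x_sub_x hA hδ hδL hσ hσ2)).norm.const_mul B
      simpa using this
    filter_upwards [h1.eventually (gt_mem_nhds (half_pos hm))] with k hk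
    have h2 := (abs_le.1 (abs_real_inner_le_norm (y (k + 1)) (K (x (k + 1)) - K (x k)))).1
    have h3 := mul_le_mul_of_nonneg_right (hB k) (norm_nonneg (K (x (k + 1)) - K (x k)))
    rw [map_sub] at hk
    simp only [hG, hi.fenchelReal_eq hA]
    linarith [hmfk k]
  obtain ⟨N, hN⟩ := eventually_atTop.1 (hGev.and ((tendsto_add_atTop_nat 1).eventually hcalm))
  have hGle : ∀ k, G k ≤ M := fun k => by
    simp only [hG, hi.fenchelReal_eq hA]
    exact (hi.linearized_f_le hA k).trans (hfM _ (hi.x_mem k))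
  set r : ℕ → ℝ := fun k => phiReal g h δ (x (k + 1)) (u (k + 1)) / G k with hr
  have hGpos : ∀ k, N ≤ k → 0 < G k := fun k hk => by linarith [(hN k hk).1]
  have hθr : ∀ k, N ≤ k → θ (k + 1) ≤ r k := fun k hk => by
    rw [hi.theta_eq_div hA]
    refine div_le_div_of_nonneg_left
      (hA.phiReal_nonneg hδ (hi.x_mem k) (hi.g_ne_top hA _) _) (hGpos k hk) ?_
    simp only [hG, hi.fenchelReal_eq hA]
    exact hi.linearized_f_le hA k
  have hrθ : ∀ k, N ≤ k → r k + c / M * stepLength x u k ^ 2 ≤ θ k := fun k hk => by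
    have h1 := hdec k
    rw [← hi.fenchelReal_eq hA] at h1
    have h2 : c / M * stepLength x u k ^ 2 * G k ≤ c * stepLength x u k ^ 2 := by
      calc _ ≤ c / M * stepLength x u k ^ 2 * M := by gcongr; exact hGle k
        _ = _ := by field_simp
    refine le_of_mul_le_mul_right ?_ (hGpos k hk)
    rw [add_mul, hr]
    simp only
    rw [div_mul_cancel₀ _ (hGpos k hk).ne']
    linarith
  have hrθ' : ∀ k, N ≤ k → r k ≤ θ k := fun k hk =>
    (le_add_of_nonneg_right (by positivity)).trans (hrθ k hk)
  -- The values of ϖ are squeezed between θ (k + 1) and θ k.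
  have hrρ : Tendsto r atTop (𝓝 ρ) :=
    tendsto_of_tendsto_of_tendsto_of_le_of_le' ((tendsto_add_atTop_iff_nat 1).2 hρ) hρ
      (eventually_atTop.2 ⟨N, hθr⟩) (eventually_atTop.2 ⟨N, hrθ'⟩)
  have hdom : ∀ k, N ≤ k → (WithLp.toLp 2 (x (k + 1), WithLp.toLp 2 (y (k + 1), u (k + 1))) :
      WithLp 2 (E n × WithLp 2 (E p × E n))) ∈ varpiDomain S g f K m := fun k hk =>
    ⟨hi.x_mem k, hi.g_ne_top hA _, by
      change conjugate f (y (k + 1)) ≠ ⊤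
      rw [hi.conjugate_eq hA]; exact EReal.coe_ne_top _, (hN k hk).1⟩
  set κ := ‖ContinuousLinearMap.adjoint K‖ with hκ
  have hκ0 : 0 ≤ κ := norm_nonneg _
  set C := 1 / (m / 2) * (1 / δ + L + κ * B + (θ 0 * ‖K‖ + 1 / δ * (1 / σ))) with hC
  rw [← summable_nat_add_iff (N + 1)]
  refine hKL.summable
    (w := fun k => WithLp.toLp 2 (x (k + N + 1), WithLp.toLp 2 (y (k + N + 1), u (k + N + 1))))
    (v := fun k => (1 / G (k + N)) • ((WithLp.toLp 2 (proxSubgradient h K δ x y u θ (k + N)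
        + gradient h (x (k + N + 1)) + (1 / δ) • (x (k + N + 1) - u (k + N + 1)),
        WithLp.toLp 2 (0, (1 / δ) • (u (k + N + 1) - x (k + N + 1)))) :
          WithLp 2 (E n × WithLp 2 (E p × E n)))
      - r (k + N) • WithLp.toLp 2 ((ContinuousLinearMap.adjoint K) (y (k + N + 1)),
          WithLp.toLp 2 (K (x (k + N + 1)) - K (x (k + N)), 0))))
    (r := fun k => r (k + N)) (c := c / M) (C := C)
    (isCompact_closedBall 0 (R + B)) (fun k => ?_) (fun k => ?_)
    ((tendsto_add_atTop_iff_nat N).2 hrρ) (by positivity) ?_ (fun k => stepLength_nonneg _ _ _)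
    (fun k => ?_) (fun k => ?_) (fun k => ?_) ?_
  · rw [mem_closedBall_zero_iff]
    refine (norm_toLp_prod_le _ _).trans ?_
    have h1 := norm_toLp_prod_le (y (k + N + 1)) (u (k + N + 1))
    linarith [hR (k + N), hB (k + N)]
  · exact hA.varpiFun_eq (hdom (k + N) (by omega))
  · rw [hC]
    have := hθ0 0
    positivity
  · have h1 := hrθ (k + N + 1) (by omega)
    have h2 := hθr (k + N) (by omega)
    rw [show k + 1 + N = k + N + 1 by omega, show k + (N + 1) = k + N + 1 by omega]
    exact h1.trans h2
  · exact hA.mem_frechetSubdiff_varpiFun hδ hm (hdom (k + N) (by omega))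
      (fun z hz hgz => hi.g_subgradient hA hδ (k + N) hz hgz) (hA.f_ne_top (hi.mem (k + N)))
      (by rw [hi.conjugate_eq hA, EReal.toReal_coe]) (hN (k + N) (by omega)).2.continuousAt_toReal
  · rw [show k + 1 + N = k + N + 1 by omega, show k + (N + 1) = k + N + 1 by omega]
    have hθr' := hθr (k + N) (by omega)
    have hrr' := hrθ' (k + N + 1) (by omega)
    generalize hj : k + N + 1 = j at *
    have hjN : N ≤ j := by omega
    have hGm := (hN j hjN).1
    have hs := stepLength_nonneg x u j
    have hr0 : 0 ≤ r j := (hθ0 _).trans (hθr j hjN)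
    have hrj : r j ≤ θ 0 := hrr'.trans (hanti (Nat.zero_le j))
    -- The same dual vector occurs twice, so no continuity of y is needed: only θ j - r j remains,
    -- and θ j ≤ r (j - 1) with j - 1 = k + N.
    have h1 : ‖θ j • y (j + 1) - r j • y (j + 1)‖ ≤ B * (r (k + N) - r j) := by
      rw [← sub_smul, norm_smul, Real.norm_of_nonneg (sub_nonneg.2 hrr'), mul_comm]
      exact mul_le_mul (hB j) (by linarith) (sub_nonneg.2 hrr') hB0
    have h2 := hi.norm_residual_le hA hδ j (r j) (y (j + 1))
    have h3 := hi.norm_residual_u_le hδ hσ hσ2 j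
    have h4 := mul_le_mul_of_nonneg_left h1 hκ0
    have h5 : ‖(0 : E p) - r j • (K (x (j + 1)) - K (x j))‖ ≤ θ 0 * ‖K‖ * stepLength x u j := by
      rw [zero_sub, norm_neg, norm_smul, Real.norm_of_nonneg hr0, mul_assoc]
      exact mul_le_mul hrj (norm_K_sub_le K x u j) (norm_nonneg _) (hθ0 0)
    rw [toLp_prod_sub_smul, toLp_prod_sub_smul, smul_zero, sub_zero, norm_smul,
      Real.norm_of_nonneg (one_div_nonneg.2 (by linarith)), hC, mul_assoc]
    refine mul_le_mul (one_div_le_one_div_of_le (half_pos hm) hGm.le)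
      ((norm_toLp_prod_le _ _).trans ((add_le_add h2 ((norm_toLp_prod_le _ _).trans
        (add_le_add h5 h3))).trans ?_)) (norm_nonneg _) (by positivity)
    have t0 : 0 ≤ r (k + N) - r j := by linarith
    have t1 : 0 ≤ (1 / δ + L + (θ 0 * ‖K‖ + 1 / δ * (1 / σ))) * (r (k + N) - r j) := by
      have := hθ0 0
      positivity
    have t2 : 0 ≤ κ * B * stepLength x u j := by positivity
    nlinarith
  · intro ψ a hψ ha
    have hψt : Tendsto (fun j => ψ j + N) atTop atTop :=
      (tendsto_add_atTop_nat N).comp hψ.tendsto_atTop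
    have ha1 : Tendsto (fun j => x (ψ j + N + 1)) atTop (𝓝 a.fst) :=
      (continuous_prod_fst.tendsto a).comp ha
    have ha2 : Tendsto (fun j => y (ψ j + N + 1)) atTop (𝓝 a.snd.fst) :=
      ((continuous_prod_fst.comp continuous_prod_snd).tendsto a).comp ha
    have ha3 : Tendsto (fun j => u (ψ j + N + 1)) atTop (𝓝 a.snd.snd) :=
      ((continuous_prod_snd.comp continuous_prod_snd).tendsto a).comp ha
    obtain ⟨haS, hga, -⟩ := hi.tendsto_g hA hδ hδL hσ hσ2 (ψ := fun j => ψ j + N) ha1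
    have ha0 := hi.tendsto_x_of_tendsto_succ hA hδ hδL hσ hσ2 hψt ha1
    have h1 : a.fst - a.snd.snd = 0 := tendsto_nhds_unique (ha1.sub ha3)
      ((hi.tendsto_x_sub_u hA hδ hδL hσ hσ2).2.comp hψt)
    -- The limit of y is a subgradient of `f` at the limit of K x. Equality in Fenchel–Young then
    -- gives the denominator f(K a) ≥ m > m/2, so the cluster point lies in the domain of ϖ.
    have h2 := hA.proper_f.conjugate_eq (v := a.snd.fst) (hA.f_ne_top haS)
      fun z hz => hi.f_subgradient_of_tendsto hA haS ha0 ha2 hz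
    have h3 : fenchelReal f K a.fst a.snd.fst = (f (K a.fst)).toReal := by
      rw [fenchelReal, h2, EReal.toReal_coe]
      ring
    have h4 : m ≤ (f (K a.fst)).toReal :=
      ge_of_tendsto ((hA.continuousAt_f haS).tendsto.comp ((K.continuous.tendsto _).comp ha0))
        (Eventually.of_forall fun j => (hmfk _).le)
    have hmem : a ∈ varpiDomain S g f K m := ⟨haS, hga, by rw [h2]; exact EReal.coe_ne_top _, by
      rw [h3]; linarith⟩
    rw [hA.varpiFun_eq hmem, h3, tendsto_nhds_unique hρ
      (hi.tendsto_theta_of_tendsto hA hδ hδL hσ hσ2 hψt ha1), phiReal, h1]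
    simp

end Calm

end FracProg

/-! ### The convergence theorem -/

open FracProg
theorem mainTheorem1 {n p : ℕ} (S : Set (E n)) (g : E n → EReal) (h : E n → ℝ) (L : NNReal)
    (f : E p → EReal) (K : E n →L[ℝ] E p) (δ σ : ℝ)
    (x : ℕ → E n) (y : ℕ → E p) (u : ℕ → E n) (θ : ℕ → ℝ)
    (hA : StandingAssumptions S g h L f K)
    (hQ : QualificationCondition S g)
    (hδ : 0 < δ) (hδL : δ * (L : ℝ) < 1) (hσ : 0 < σ) (hσ2 : σ < 2)
    (hiter : IsFPSA S g h f K δ σ x y u θ)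
    (hcond :
      ((∀ᶠ k in atTop, CalmAt (conjugate f) (y k)) ∧
        ∃ m : ℝ, 0 < m ∧ (m : EReal) < ⨅ k, f (K (x k)) ∧ HasKL (varpiFun S g h f K δ m)) ∨
      (SmoothNear f (K '' S) ∧ HasKL (varthetaFun S g h f K δ))) :
    Summable (fun k => ‖x k - x (k + 1)‖ + ‖u k - u (k + 1)‖) ∧
      ∃ a : E n, Tendsto x atTop (𝓝 a) ∧ IsLiftedStationary S g h f K a := by
  have hsum : Summable (stepLength x u) := by
    rcases hcond with ⟨hcalm, m, hm, hmf, hKL⟩ | ⟨hsm, hKL⟩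
    · exact hiter.summable_of_calm hA hδ hδL hσ hσ2 hcalm hm hmf hKL
    · exact hiter.summable_of_smooth hA hδ hδL hσ hσ2 hsm hKL
  refine ⟨hsum, ?_⟩
  have hx : Summable fun k => dist (x k) (x (k + 1)) :=
    Summable.of_nonneg_of_le (fun _ => dist_nonneg) (fun k => by
      rw [dist_eq_norm, stepLength]
      linarith [norm_nonneg (u k - u (k + 1))]) hsum
  obtain ⟨a, ha⟩ := cauchySeq_tendsto_of_complete (cauchySeq_of_summable_dist hx)
  exact ⟨a, ha, hiter.isLiftedStationary hA hQ hδ hδL hσ hσ2 ha⟩
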